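/- **Theorem.** Let $X$, $\mathbf X$ and $U$ be Banach spaces over $\mathbb R$ or $\mathbb C$, let $A$ be the generator of a $C_0$-semigroup $e^{At}$ on $X$, and let $\mathbf A$ be the generator of a $C_0$-semigroup $e^{\mathbf A t}$ on $\mathbf X$. Fix $\lambda_0$ in the resolvent set of $A$ and let $X_{-1}$ be the extrapolation space of $X$, that is, the completion of $X$ under the norm $\|(\lambda_0-A)^{-1}\cdot\|$; the operators $e^{At}$ extend by continuity to bounded operators on $X_{-1}$, and $A$ extends by continuity to a bounded operator $X\to X_{-1}$ (both extensions are denoted by the same letters). Equip $D(\mathbf A)$ with the graph norm. Let $B\in L(U,X_{-1})$ be an admissible control operator for $e^{At}$: for some $t_0>0$ there is $K\ge 0$ such that for every $u\in L^2_{loc}([0,\infty);U)$ the integral $\int_0^{t_0}e^{A(t_0-s)}Bu(s)\,ds$, taken in $X_{-1}$, belongs to $X$, and $$\Big\|\int_0^{t_0}e^{A(t_0-s)}Bu(s)\,ds\Big\|_X\le K\Big(\int_0^{t_0}\|u(s)\|^2ds\Big)^{1/2}.$$ Let $C\in L(D(\mathbf A),U)$ be an admissible observation operator for $e^{\mathbf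 At}$: for some $t_0>0$ there is $K\ge 0$ such that $$\int_0^{t_0}\|Ce^{\mathbf As}x\|^2ds\le K^2\|x\|^2\qquad\text{for all }x\in D(\mathbf A).$$ Then the operator $$\mathfrak A=\begin{pmatrix}A&BC\\0&\mathbf A\end{pmatrix},\qquad D(\mathfrak A)=\{(f,g)\in X\times D(\mathbf A): Af+BCg\in X\},\qquad \mathfrak A(f,g)=(Af+BCg,\ \mathbf Ag),$$ where $Af+BCg$ is computed in $X_{-1}$, generates a $C_0$-semigroup $e^{\mathfrak At}$ on $X\times\mathbf X$. If, in addition, both $e^{At}$ and $e^{\mathbf At}$ are exponentially stable (a semigroup $T(t)$ is exponentially stable if there are $M,\omega>0$ with $\|T(t)\|\le Me^{-\omega t}$ for all $t\ge0$), then $e^{\mathfrak At}$ is exponentially stable. -/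

import Mathlib

open MeasureTheory Filter Topology Set
open scoped NNReal

noncomputable section

variable {𝕜 : Type*} [RCLike 𝕜] {X : Type*} [NormedAddCommGroup X] [NormedSpace 𝕜 X]

/-! ### Strongly continuous semigroups and their generators -/

/-- A `C₀`-semigroup (strongly continuous one-parameter semigroup of bounded linear operators)
on `X`, indexed by the times `t ≥ 0`. -/
structure C0Semigroup (𝕜 : Type*) [RCLike 𝕜] (X : Type*) [NormedAddCommGroup X]
    [NormedSpace 𝕜 X] where
  /-- The operator at time `t`. -/
  op : ℝ≥0 → X →L[𝕜] X
  op_zero : op 0 = ContinuousLinearMap.id 𝕜 X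
  op_add : ∀ s t : ℝ≥0, op (s + t) = (op s).comp (op t)
  continuous_op : ∀ x : X, Continuous fun t : ℝ≥0 => op t x

namespace C0Semigroup

/-- Exponential stability: `‖T(t)‖ ≤ M e^{-ωt}` for some `M, ω > 0` and all `t ≥ 0`. -/
def ExpStable (T : C0Semigroup 𝕜 X) : Prop :=
  ∃ M ω : ℝ, 0 < M ∧ 0 < ω ∧ ∀ t : ℝ≥0, ‖T.op t‖ ≤ M * Real.exp (-ω * t)

/-- `y = lim_{h → 0+} (T(h)x - x)/h`. -/
def HasGen (T : C0Semigroup 𝕜 X) (x y : X) : Prop :=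
  Tendsto (fun h : ℝ≥0 => ((h : ℝ) : 𝕜)⁻¹ • (T.op h x - x)) (𝓝[>] 0) (𝓝 y)

theorem HasGen.unique {T : C0Semigroup 𝕜 X} {x y z : X} (h₁ : T.HasGen x y)
    (h₂ : T.HasGen x z) : y = z :=
  tendsto_nhds_unique h₁ h₂

theorem HasGen.add {T : C0Semigroup 𝕜 X} {x x' y y' : X} (h₁ : T.HasGen x y)
    (h₂ : T.HasGen x' y') : T.HasGen (x + x') (y + y') := by
  refine (Tendsto.add h₁ h₂).congr fun h => ?_
  rw [← smul_add, map_add]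
  congr 1
  abel

theorem HasGen.smul {T : C0Semigroup 𝕜 X} {x y : X} (c : 𝕜) (h₁ : T.HasGen x y) :
    T.HasGen (c • x) (c • y) := by
  refine (Tendsto.const_smul h₁ c).congr fun h => ?_
  rw [map_smul, ← smul_sub, smul_comm]

theorem HasGen.zero (T : C0Semigroup 𝕜 X) : T.HasGen 0 0 := by
  simp [HasGen]

theorem HasGen.apply {T : C0Semigroup 𝕜 X} {x y : X} (h₁ : T.HasGen x y) (t : ℝ≥0) :
    T.HasGen (T.op t x) (T.op t y) := by
  refine (((T.op t).continuous.tendsto y).comp h₁).congr fun h => ?_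
  have e : T.op t (T.op h x) = T.op h (T.op t x) := by
    have := T.op_add t h
    rw [add_comm, T.op_add] at this
    exact (DFunLike.congr_fun this x).symm
  simp only [Function.comp_apply, map_smul, map_sub, e]

/-- The (infinitesimal) generator of a `C₀`-semigroup, as an unbounded operator. -/
def generator (T : C0Semigroup 𝕜 X) : X →ₗ.[𝕜] X where
  domain :=
    { carrier := {x | ∃ y, T.HasGen x y}
      add_mem' := fun ⟨_, h₁⟩ ⟨_, h₂⟩ => ⟨_, h₁.add h₂⟩
      zero_mem' := ⟨0, HasGen.zero T⟩
      smul_mem' := fun c _ ⟨_, h⟩ => ⟨_, h.smul c⟩ }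
  toFun :=
    { toFun := fun x => x.2.choose
      map_add' := fun x y =>
        (x + y).2.choose_spec.unique (x.2.choose_spec.add y.2.choose_spec)
      map_smul' := fun c x => (c • x).2.choose_spec.unique (x.2.choose_spec.smul c) }

theorem hasGen_generator (T : C0Semigroup 𝕜 X) (x : T.generator.domain) :
    T.HasGen (x : X) (T.generator x) :=
  x.2.choose_spec

theorem op_mem_domain (T : C0Semigroup 𝕜 X) (t : ℝ≥0) (x : T.generator.domain) :
    T.op t (x : X) ∈ T.generator.domain :=
  ⟨_, (T.hasGen_generator x).apply t⟩

theorem generator_op (T : C0Semigroup 𝕜 X) (t : ℝ≥0) (x : T.generator.domain) :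
    T.generator ⟨T.op t x, T.op_mem_domain t x⟩ = T.op t (T.generator x) :=
  (T.hasGen_generator _).unique ((T.hasGen_generator x).apply t)

end C0Semigroup

/-! ### Resolvents -/

/-- `R` is the resolvent `(lam - A)⁻¹` of the unbounded operator `A` at `lam`: a bounded operator
with values in `D(A)` that is a two-sided inverse of `lam - A : D(A) → X`. -/
def LinearPMap.IsResolvent (A : X →ₗ.[𝕜] X) (lam : 𝕜) (R : X →L[𝕜] X) : Prop :=
  (∀ x : X, ∃ h : R x ∈ A.domain, lam • R x - A ⟨R x, h⟩ = x) ∧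
    ∀ x : A.domain, R (lam • (x : X) - A x) = x

/-- The resolvent set `ρ(A)`. -/
def LinearPMap.resolventSet (A : X →ₗ.[𝕜] X) : Set 𝕜 :=
  {lam | ∃ R : X →L[𝕜] X, A.IsResolvent lam R}

namespace C0Semigroup

variable (T : C0Semigroup 𝕜 X) (lam : 𝕜) (hlam : lam ∈ T.generator.resolventSet)

/-- The resolvent `R(lam, A)` of the generator `A` of `T`, for `lam ∈ ρ(A)`. -/
def resolventOp : X →L[𝕜] X := Exists.choose hlam

theorem isResolvent_resolventOp : T.generator.IsResolvent lam (T.resolventOp lam hlam) :=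
  Exists.choose_spec hlam

theorem resolventOp_injective : Function.Injective (T.resolventOp lam hlam) := by
  rw [injective_iff_map_eq_zero]
  intro x hx
  obtain ⟨h, e⟩ := (T.isResolvent_resolventOp lam hlam).1 x
  have h0 : (⟨T.resolventOp lam hlam x, h⟩ : T.generator.domain) = 0 := Subtype.ext hx
  rw [h0, LinearPMap.map_zero, hx, smul_zero, sub_zero] at e
  exact e.symm

theorem resolventOp_op (t : ℝ≥0) (x : X) :
    T.resolventOp lam hlam (T.op t x) = T.op t (T.resolventOp lam hlam x) := by
  obtain ⟨h, e⟩ := (T.isResolvent_resolventOp lam hlam).1 x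
  have e2 := (T.isResolvent_resolventOp lam hlam).2 ⟨_, T.op_mem_domain t ⟨_, h⟩⟩
  rw [generator_op, ← map_smul, ← map_sub, e] at e2
  exact e2

/-! ### The extrapolation space -/

/-- The vector space `X`, to be normed by `x ↦ ‖R(lam, A) x‖`. -/
@[nolint unusedArguments]
def PreExtrap (_T : C0Semigroup 𝕜 X) (lam : 𝕜)
    (_hlam : lam ∈ _T.generator.resolventSet) : Type _ := X

instance : AddCommGroup (T.PreExtrap lam hlam) := inferInstanceAs (AddCommGroup X)

instance : Module 𝕜 (T.PreExtrap lam hlam) := inferInstanceAs (Module 𝕜 X)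

/-- The identity map from `X` to `PreExtrap`. -/
def toPre : X ≃ₗ[𝕜] T.PreExtrap lam hlam := LinearEquiv.refl 𝕜 X

/-- The resolvent as a linear map on `PreExtrap`. -/
def preResolvent : T.PreExtrap lam hlam →ₗ[𝕜] X :=
  (T.resolventOp lam hlam : X →ₗ[𝕜] X) ∘ₗ ((T.toPre lam hlam).symm : _ →ₗ[𝕜] X)

instance : NormedAddCommGroup (T.PreExtrap lam hlam) :=
  NormedAddCommGroup.induced _ X (T.preResolvent lam hlam)
    ((T.resolventOp_injective lam hlam).comp (T.toPre lam hlam).symm.injective)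

instance : NormedSpace 𝕜 (T.PreExtrap lam hlam) :=
  NormedSpace.induced 𝕜 _ X (T.preResolvent lam hlam)

theorem norm_toPre (x : X) : ‖T.toPre lam hlam x‖ = ‖T.resolventOp lam hlam x‖ := rfl

/-- The extrapolation space `X_{-1}`: the completion of `X` for the norm `‖R(lam, A) ·‖`. -/
abbrev Extrap : Type _ := UniformSpace.Completion (T.PreExtrap lam hlam)

/-- The embedding of `X` into `X_{-1}`. -/
def incl : X →L[𝕜] T.Extrap lam hlam :=
  (UniformSpace.Completion.toComplL (𝕜 := 𝕜) (E := T.PreExtrap lam hlam)).comp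
    ((T.toPre lam hlam : X →ₗ[𝕜] T.PreExtrap lam hlam).mkContinuous
      ‖T.resolventOp lam hlam‖ fun x => (T.resolventOp lam hlam).le_opNorm x)

theorem norm_incl (x : X) : ‖T.incl lam hlam x‖ = ‖T.resolventOp lam hlam x‖ :=
  UniformSpace.Completion.norm_coe (T.toPre lam hlam x)

theorem incl_injective : Function.Injective (T.incl lam hlam) := fun _ _ h =>
  (T.toPre lam hlam).injective (UniformSpace.Completion.coe_injective _ h)

/-- The operator `T(t)` on `X` with the norm `‖R(lam, A) ·‖`. -/
def preOp (t : ℝ≥0) : T.PreExtrap lam hlam →L[𝕜] T.PreExtrap lam hlam :=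
  ((T.toPre lam hlam : X →ₗ[𝕜] T.PreExtrap lam hlam) ∘ₗ (T.op t : X →ₗ[𝕜] X) ∘ₗ
    ((T.toPre lam hlam).symm : T.PreExtrap lam hlam →ₗ[𝕜] X)).mkContinuous ‖T.op t‖ fun x => by
      obtain ⟨x, rfl⟩ := (T.toPre lam hlam).surjective x
      simp only [LinearMap.comp_apply, LinearEquiv.coe_coe, LinearEquiv.symm_apply_apply,
        ContinuousLinearMap.coe_coe, norm_toPre, resolventOp_op]
      exact (T.op t).le_opNorm _

/-- The extension of `T(t)` by continuity to `X_{-1}`. -/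
def extrapOp (t : ℝ≥0) : T.Extrap lam hlam →L[𝕜] T.Extrap lam hlam :=
  (T.preOp lam hlam t).completion

theorem extrapOp_incl (t : ℝ≥0) (x : X) :
    T.extrapOp lam hlam t (T.incl lam hlam x) = T.incl lam hlam (T.op t x) :=
  UniformSpace.Completion.map_coe (T.preOp lam hlam t).uniformContinuous (T.toPre lam hlam x)

/-- The extension of the generator `A` by continuity (along the dense subspace `D(A) ⊆ X`) to a
bounded operator from `X` to `X_{-1}`. -/
def extrapGen : X →L[𝕜] T.Extrap lam hlam :=
  ((T.incl lam hlam : X →ₗ[𝕜] T.Extrap lam hlam) ∘ₗ T.generator.toFun).extendOfNorm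
    T.generator.domain.subtype

/-- The generator of a `C₀`-semigroup on a Banach space is densely defined. -/
theorem dense_domain [CompleteSpace X] : Dense (T.generator.domain : Set X) := by
  let _ : NormedSpace ℝ X := NormedSpace.restrictScalars ℝ 𝕜 X
  have hsm : ∀ (a : ℝ) (x : X), (a : 𝕜) • x = a • x := fun a x => rfl
  intro x
  set g : ℝ → X := fun s => T.op s.toNNReal x with hg
  have hgc : Continuous g := (T.continuous_op x).comp continuous_real_toNNReal
  set F : ℝ → X := fun r => ∫ s in (0 : ℝ)..r, g s with hF
  have hF0 : F 0 = 0 := by simp [hF]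
  have hFd : ∀ r, HasDerivAt F (g r) r := fun r =>
    intervalIntegral.integral_hasDerivAt_right (hgc.intervalIntegrable _ _)
      (hgc.stronglyMeasurableAtFilter _ _) hgc.continuousAt
  have hg0 : g 0 = x := by simp [hg, T.op_zero]
  have hlim : ∀ f : ℝ → X, ∀ r : ℝ, ∀ y : X, HasDerivAt f y r →
      Tendsto (fun h : ℝ≥0 => ((h : ℝ) : 𝕜)⁻¹ • (f (r + h) - f r)) (𝓝[>] 0) (𝓝 y) := by
    intro f r y hf
    have h1 := hasDerivAt_iff_tendsto_slope_zero.1 hf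
    have h2 : Tendsto (fun h : ℝ≥0 => (h : ℝ)) (𝓝[>] 0) (𝓝[≠] 0) := by
      refine tendsto_nhdsWithin_iff.2 ⟨?_, ?_⟩
      · exact (NNReal.continuous_coe.tendsto 0).mono_left nhdsWithin_le_nhds
      · filter_upwards [self_mem_nhdsWithin] with h hh
        exact NNReal.coe_ne_zero.2 (ne_of_gt hh)
    refine (h1.comp h2).congr fun h => ?_
    rw [← RCLike.ofReal_inv, hsm]
    rfl
  have hmem : ∀ t : ℝ≥0, F t ∈ T.generator.domain := by
    intro t
    refine ⟨g t - g 0, ?_⟩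
    have h1 := (hlim F t _ (hFd t)).sub (hlim F 0 _ (hFd 0))
    refine h1.congr fun h => ?_
    rw [← smul_sub, hF0, sub_zero, zero_add]
    congr 1
    have h2 : T.op h (F t) = F (t + h) - F h := by
      have e1 : T.op h (F t) = ∫ s in (0 : ℝ)..t, T.op h (g s) :=
        (((T.op h).restrictScalars ℝ).intervalIntegral_comp_comm
          (hgc.intervalIntegrable _ _)).symm
      have e2 : ∫ s in (0 : ℝ)..t, T.op h (g s) = ∫ s in (0 : ℝ)..t, g (s + h) := by
        refine intervalIntegral.integral_congr fun s hs => ?_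
        rw [uIcc_of_le (show (0 : ℝ) ≤ t from t.2)] at hs
        simp only [hg]
        have e3 : (s + (h : ℝ)).toNNReal = h + s.toNNReal := by
          rw [Real.toNNReal_add hs.1 (NNReal.coe_nonneg h), Real.toNNReal_coe, add_comm]
        rw [e3, T.op_add]
        rfl
      rw [e1, e2, intervalIntegral.integral_comp_add_right, zero_add, hF]
      exact (intervalIntegral.integral_interval_sub_left (hgc.intervalIntegrable _ _)
        (hgc.intervalIntegrable _ _)).symm
    rw [h2]
    abel
  have h3 := hlim F 0 _ (hFd 0)
  rw [hg0] at h3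
  refine mem_closure_of_tendsto h3 (Eventually.of_forall fun h => ?_)
  rw [hF0, sub_zero, zero_add]
  exact Submodule.smul_mem _ _ (hmem h)

/-- `extrapGen` extends the generator. -/
theorem extrapGen_apply [CompleteSpace X] (x : T.generator.domain) :
    T.extrapGen lam hlam (x : X) = T.incl lam hlam (T.generator x) := by
  refine LinearMap.extendOfNorm_eq ?_ ?_ x
  · simpa [DenseRange] using T.dense_domain
  · refine ⟨‖lam‖ * ‖T.resolventOp lam hlam‖ + 1, fun x => ?_⟩
    have e := (T.isResolvent_resolventOp lam hlam).2 x
    rw [map_sub, map_smul, sub_eq_iff_eq_add, ← sub_eq_iff_eq_add'] at e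
    change ‖T.incl lam hlam (T.generator x)‖ ≤ _ * ‖(x : X)‖
    rw [norm_incl, ← e, add_mul, one_mul, mul_assoc]
    refine (norm_sub_le _ _).trans ?_
    rw [norm_smul]
    gcongr
    exact (T.resolventOp lam hlam).le_opNorm _

/-! ### Admissibility -/

variable {U : Type*} [NormedAddCommGroup U] [NormedSpace 𝕜 U]

/-- `u ∈ L²_loc([0, ∞); U)`. -/
def _root_.LocSqIntegrable (u : ℝ → U) : Prop :=
  ∀ τ : ℝ, 0 < τ → MemLp u 2 (volume.restrict (Ioc 0 τ))

/-- The Bochner integral `∫₀ᵗ e^{A(t-s)} B u(s) ds` in `X_{-1}`. -/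
def controlInt (B : U →L[𝕜] T.Extrap lam hlam) (t : ℝ) (u : ℝ → U) : T.Extrap lam hlam :=
  letI : NormedSpace ℝ (T.Extrap lam hlam) := NormedSpace.restrictScalars ℝ 𝕜 _
  ∫ s in (0 : ℝ)..t, T.extrapOp lam hlam (t - s).toNNReal (B (u s))

/-- `B ∈ L(U, X_{-1})` is an admissible control operator for `T`: for some `t₀ > 0`, the integral
`∫₀^{t₀} e^{A(t₀-s)} B u(s) ds` lies in `X` for all `u ∈ L²_loc`, with norm in `X` at most
`K ‖u‖_{L²(0, t₀)}`. -/
def AdmissibleControl (B : U →L[𝕜] T.Extrap lam hlam) : Prop :=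
  ∃ t₀ K : ℝ, 0 < t₀ ∧ 0 ≤ K ∧ ∀ u : ℝ → U, LocSqIntegrable u →
    ∃ z : X, T.incl lam hlam z = T.controlInt lam hlam B t₀ u ∧
      ‖z‖ ≤ K * √(∫ s in (0 : ℝ)..t₀, ‖u s‖ ^ 2)

/-- `C : D(A) → U` is bounded for the graph norm, that is, `C ∈ L(D(A), U)`. -/
def _root_.LinearPMap.GraphBounded (A : X →ₗ.[𝕜] X) (C : A.domain →ₗ[𝕜] U) : Prop :=
  ∃ c : ℝ, ∀ x : A.domain, ‖C x‖ ≤ c * (‖(x : X)‖ + ‖A x‖)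

/-- `C ∈ L(D(A), U)` is an admissible observation operator for `T`: for some `t₀ > 0` and `K ≥ 0`,
`∫₀^{t₀} ‖C e^{As} x‖² ds ≤ K² ‖x‖²` for all `x ∈ D(A)`. -/
def AdmissibleObservation (C : T.generator.domain →ₗ[𝕜] U) : Prop :=
  ∃ t₀ K : ℝ, 0 < t₀ ∧ 0 ≤ K ∧ ∀ x : T.generator.domain,
    ∫ s in (0 : ℝ)..t₀, ‖C ⟨T.op s.toNNReal (x : X), T.op_mem_domain s.toNNReal x⟩‖ ^ 2
      ≤ K ^ 2 * ‖(x : X)‖ ^ 2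

/-! ### The coupled operator -/

variable {Y : Type*} [NormedAddCommGroup Y] [NormedSpace 𝕜 Y] (S : C0Semigroup 𝕜 Y)

/-- For `p = (f, g)`: `g ∈ D(𝐀)` and `A f + B C g = z ∈ X`, as an identity in `X_{-1}`, where `A f`
is the extension of `A` to an operator from `X` to `X_{-1}`. -/
def IsCoupled (B : U →L[𝕜] T.Extrap lam hlam) (C : S.generator.domain →ₗ[𝕜] U)
    (p : X × Y) (z : X) : Prop :=
  ∃ hg : p.2 ∈ S.generator.domain,
    T.extrapGen lam hlam p.1 + B (C ⟨p.2, hg⟩) = T.incl lam hlam z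

variable {T lam hlam S}
variable {B : U →L[𝕜] T.Extrap lam hlam} {C : S.generator.domain →ₗ[𝕜] U}

theorem IsCoupled.unique {p : X × Y} {z w : X} (h₁ : T.IsCoupled lam hlam S B C p z)
    (h₂ : T.IsCoupled lam hlam S B C p w) : z = w := by
  obtain ⟨_, h₁⟩ := h₁
  obtain ⟨_, h₂⟩ := h₂
  exact T.incl_injective lam hlam (h₁.symm.trans h₂)

theorem IsCoupled.add {p q : X × Y} {z w : X} (h₁ : T.IsCoupled lam hlam S B C p z)
    (h₂ : T.IsCoupled lam hlam S B C q w) : T.IsCoupled lam hlam S B C (p + q) (z + w) := by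
  obtain ⟨hp, h₁⟩ := h₁
  obtain ⟨hq, h₂⟩ := h₂
  have e : C ⟨(p + q).2, add_mem hp hq⟩ = C ⟨p.2, hp⟩ + C ⟨q.2, hq⟩ :=
    map_add C ⟨p.2, hp⟩ ⟨q.2, hq⟩
  refine ⟨add_mem hp hq, ?_⟩
  rw [e, Prod.fst_add, map_add, map_add, map_add, ← h₁, ← h₂]
  abel

theorem IsCoupled.smul {p : X × Y} {z : X} (c : 𝕜) (h₁ : T.IsCoupled lam hlam S B C p z) :
    T.IsCoupled lam hlam S B C (c • p) (c • z) := by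
  obtain ⟨hp, h₁⟩ := h₁
  have e : C ⟨(c • p).2, Submodule.smul_mem _ c hp⟩ = c • C ⟨p.2, hp⟩ := map_smul C c ⟨p.2, hp⟩
  refine ⟨Submodule.smul_mem _ c hp, ?_⟩
  rw [e, Prod.smul_fst, map_smul, map_smul, map_smul, ← h₁, smul_add]

theorem IsCoupled.zero : T.IsCoupled lam hlam S B C 0 0 := by
  have e : C ⟨(0 : X × Y).2, zero_mem _⟩ = 0 := map_zero C
  refine ⟨zero_mem _, ?_⟩
  rw [e, Prod.fst_zero, map_zero, map_zero, map_zero, add_zero]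

variable (T lam hlam S B C)

/-- The operator matrix `[[A, B C], [0, 𝐀]]` on `X × Y`, with domain
`{(f, g) ∈ X × D(𝐀) : A f + B C g ∈ X}`; its value at `(f, g)` is `(A f + B C g, 𝐀 g)`. -/
def coupledOp : X × Y →ₗ.[𝕜] X × Y where
  domain :=
    { carrier := {p | ∃ z, T.IsCoupled lam hlam S B C p z}
      add_mem' := fun ⟨_, h₁⟩ ⟨_, h₂⟩ => ⟨_, h₁.add h₂⟩
      zero_mem' := ⟨0, IsCoupled.zero⟩
      smul_mem' := fun c _ ⟨_, h⟩ => ⟨_, h.smul c⟩ }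
  toFun :=
    { toFun := fun p => (p.2.choose, S.generator ⟨(p : X × Y).2, p.2.choose_spec.choose⟩)
      map_add' := fun p q => Prod.ext
        ((p + q).2.choose_spec.unique (p.2.choose_spec.add q.2.choose_spec))
        (LinearPMap.map_add S.generator ⟨(p : X × Y).2, p.2.choose_spec.choose⟩
          ⟨(q : X × Y).2, q.2.choose_spec.choose⟩)
      map_smul' := fun c p => Prod.ext
        ((c • p).2.choose_spec.unique (p.2.choose_spec.smul c))
        (LinearPMap.map_smul S.generator c ⟨(p : X × Y).2, p.2.choose_spec.choose⟩) }

/-- The value of `coupledOp` at a point `(f, g)` of its domain. -/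
theorem coupledOp_apply (p : (T.coupledOp lam hlam S B C).domain)
    (hg : (p : X × Y).2 ∈ S.generator.domain) :
    T.incl lam hlam (T.coupledOp lam hlam S B C p).1 =
        T.extrapGen lam hlam (p : X × Y).1 + B (C ⟨(p : X × Y).2, hg⟩) ∧
      (T.coupledOp lam hlam S B C p).2 = S.generator ⟨(p : X × Y).2, hg⟩ :=
  ⟨p.2.choose_spec.choose_spec.symm, rfl⟩

end C0Semigroup

end

noncomputable section

namespace C0Semigroup

variable {𝕜 : Type*} [RCLike 𝕜] {X : Type*} [NormedAddCommGroup X] [NormedSpace 𝕜 X]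

/-! The semigroup is block triangular, `V(t)(f, g) = (T(t) f + W(t) g, S(t) g)`, where `W(t) g = ∫₀ᵗ
T(t-s) B C S(s) g ds`. For `g ∈ D(𝐀)` the output `s ↦ C S(s) g` is continuous. For short times,
admissibility of `B` puts the integral in `X` with norm at most a constant times the `L²` norm of
the output, and admissibility of `C` bounds the latter by `‖g‖`. The rule `W(s+t) = T(s) W(t) + W(s)
S(t)` carries this to all times, density of `D(𝐀)` extends `W(t)` to the whole space
(`exists_coupling`, `coupling_add`), and `ofDense` gives strong continuity.

Differentiating at `t = 0` in `X_{-1}` shows that the generator of `V` is contained in the coupled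
operator (`isCoupled_of_hasGen`). For the converse, `exists_hasGen_of_snd` completes each `g ∈ D(𝐀)`
to some `(f', g)` in the domain of the generator of `V`. If `(f, g)` is in the coupled domain, then
`A (f - f') ∈ X`, so `f - f' ∈ D(A)`, and `(f - f', 0)` also lies in the domain of the generator of
`V`.

For stability, `‖W(2s)‖ ≤ (‖T(s)‖ + ‖S(s)‖) ‖W(s)‖`. Doubling a large time repeatedly drives `W` to
zero along `2ⁿ a`, so `‖V(2ⁿ a)‖ < 1` for some `n`, which suffices by `expStable_of_norm_lt_one`. -/

theorem op_add_apply (T : C0Semigroup 𝕜 X) (s t : ℝ≥0) (x : X) :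
    T.op (s + t) x = T.op s (T.op t x) := by
  rw [T.op_add]; rfl

theorem op_zero_apply (T : C0Semigroup 𝕜 X) (x : X) : T.op 0 x = x := by
  rw [T.op_zero]; rfl

theorem hasGen_iff_mem (T : C0Semigroup 𝕜 X) {x y : X} :
    T.HasGen x y ↔ ∃ h : x ∈ T.generator.domain, T.generator ⟨x, h⟩ = y := by
  constructor
  · intro h
    exact ⟨⟨y, h⟩, (T.hasGen_generator ⟨x, ⟨y, h⟩⟩).unique h⟩
  · rintro ⟨h, rfl⟩
    exact T.hasGen_generator ⟨x, h⟩

/-! ### Local boundedness and strong continuity of semigroups -/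

/-- A strongly continuous semigroup is uniformly bounded on bounded time intervals. -/
theorem exists_norm_op_le [CompleteSpace X] (T : C0Semigroup 𝕜 X) (a : ℝ≥0) :
    ∃ M : ℝ, 0 < M ∧ ∀ t ≤ a, ‖T.op t‖ ≤ M := by
  have h : ∀ x : X, ∃ c, ∀ t : Icc (0 : ℝ≥0) a, ‖T.op t x‖ ≤ c := by
    intro x
    obtain ⟨c, hc⟩ := isCompact_Icc.exists_bound_of_continuousOn
      (T.continuous_op x).continuousOn (s := Icc 0 a)
    exact ⟨c, fun t => hc t t.2⟩
  obtain ⟨M, hM⟩ := banach_steinhaus h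
  refine ⟨max M 1, by positivity, fun t ht => (hM ⟨t, zero_le, ht⟩).trans (le_max_left _ _)⟩

/-- A semigroup of bounded operators that is bounded near time `0` and strongly continuous at `0`
on a dense set is a `C₀`-semigroup. -/
def ofDense (F : ℝ≥0 → X →L[𝕜] X) (h0 : F 0 = ContinuousLinearMap.id 𝕜 X)
    (hadd : ∀ s t, F (s + t) = (F s).comp (F t)) (δ : ℝ≥0) (hδ : 0 < δ) (M : ℝ)
    (hM : ∀ t ≤ δ, ‖F t‖ ≤ M) (D : Set X) (hD : Dense D)
    (hlim : ∀ x ∈ D, Tendsto (fun t => F t x) (𝓝 0) (𝓝 x)) : C0Semigroup 𝕜 X where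
  op := F
  op_zero := h0
  op_add := hadd
  continuous_op := by
    have hM0 : 0 ≤ M := (norm_nonneg _).trans (hM 0 zero_le)
    have hlim' : ∀ x, Tendsto (fun t => F t x) (𝓝 0) (𝓝 x) := by
      intro x
      rw [Metric.tendsto_nhds]
      intro ε hε
      -- Replacing `x` by `y` costs `(M + 1) ‖x - y‖` in the splitting below; `M + 2` leaves slack.
      have hε' : 0 < ε / (2 * (M + 2)) := by positivity
      obtain ⟨y, hy, hxy⟩ := Metric.dense_iff.1 hD x _ hε'
      rw [Metric.mem_ball, dist_comm, dist_eq_norm] at hy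
      filter_upwards [Metric.tendsto_nhds.1 (hlim y hxy) (ε / 2) (by positivity),
        Iic_mem_nhds hδ] with t ht htδ
      rw [dist_eq_norm] at ht ⊢
      have e : F t x - x = F t (x - y) + (F t y - y) - (x - y) := by rw [map_sub]; abel
      have h1 : ‖F t (x - y)‖ ≤ M * ‖x - y‖ :=
        ((F t).le_opNorm _).trans (by gcongr; exact hM t htδ)
      have h2 : (M + 2) * ‖x - y‖ < ε / 2 := by
        rw [lt_div_iff₀ (by positivity)] at hy
        linarith
      rw [e]
      refine (norm_sub_le _ _).trans_lt ?_
      have := norm_add_le (F t (x - y)) (F t y - y)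
      have := norm_nonneg (x - y)
      linarith
    -- The base is `max M 1` so that the bound increases with `n`.
    have hbd : ∀ n : ℕ, ∀ t : ℝ≥0, t ≤ n * δ → ‖F t‖ ≤ max M 1 ^ (n + 1) := by
      intro n
      induction n with
      | zero =>
        intro t ht
        have : t ≤ δ := ht.trans (by simp)
        simpa using Or.inl (hM t this)
      | succ n ih =>
        intro t ht
        rcases le_total t δ with h | h
        · calc ‖F t‖ ≤ max M 1 ^ 1 := by simpa using Or.inl (hM t h)
            _ ≤ _ := pow_le_pow_right₀ (le_max_right _ _) (by omega)
        · obtain ⟨s, rfl⟩ := exists_add_of_le h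
          have hs : s ≤ n * δ := by
            have : δ + s ≤ δ + n * δ := ht.trans (le_of_eq (by push_cast; ring))
            exact le_of_add_le_add_left this
          rw [hadd, pow_succ' (max M 1) (n + 1)]
          refine (ContinuousLinearMap.opNorm_comp_le _ _).trans ?_
          gcongr
          · exact (hM δ le_rfl).trans (le_max_left _ _)
          · exact ih s hs
    intro x
    rw [continuous_iff_continuousAt]
    intro t
    obtain ⟨n, hn⟩ := exists_nat_ge ((t + δ) / δ)
    have hn' : t + δ ≤ n * δ := by rwa [div_le_iff₀ hδ] at hn
    set L := max M 1 ^ (n + 1) with hL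
    -- With truncated subtraction, `s - t + (t - s)` is `|s - t|`. Factoring out the smaller of the
    -- two times reduces both left and right continuity to continuity at `0`.
    have key : ∀ s ≤ t + δ, ‖F s x - F t x‖ ≤ L * ‖F (s - t + (t - s)) x - x‖ := by
      intro s hs
      rcases le_total s t with h | h
      · obtain ⟨r, rfl⟩ := exists_add_of_le h
        rw [tsub_eq_zero_of_le h, zero_add, add_tsub_cancel_left, hadd, norm_sub_rev,
          ContinuousLinearMap.comp_apply, ← map_sub]
        refine ((F s).le_opNorm _).trans ?_
        gcongr
        exact hbd n s (hs.trans hn')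
      · obtain ⟨r, rfl⟩ := exists_add_of_le h
        rw [tsub_eq_zero_of_le h, add_zero, add_tsub_cancel_left, hadd,
          ContinuousLinearMap.comp_apply, ← map_sub]
        refine ((F t).le_opNorm _).trans ?_
        gcongr
        exact hbd n t (le_self_add.trans hn')
    have hs0 : Tendsto (fun s : ℝ≥0 => s - t + (t - s)) (𝓝 t) (𝓝 0) := by
      have : Continuous fun s : ℝ≥0 => s - t + (t - s) := by fun_prop
      simpa using this.tendsto t
    have h1 : Tendsto (fun s => L * ‖F (s - t + (t - s)) x - x‖) (𝓝 t) (𝓝 0) := by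
      have := (((hlim' x).comp hs0).sub_const x).norm.const_mul L
      simpa using this
    rw [ContinuousAt, tendsto_iff_norm_sub_tendsto_zero]
    refine squeeze_zero' (Eventually.of_forall fun s => norm_nonneg _) ?_ h1
    filter_upwards [Iic_mem_nhds (show t < t + δ from lt_add_of_pos_right t hδ)] with s hs
    exact key s hs

/-- Joint continuity of `(t, x) ↦ T(t) x`. -/
theorem continuous_op_apply [CompleteSpace X] (T : C0Semigroup 𝕜 X) {Z : Type*}
    [TopologicalSpace Z] {σ : Z → ℝ≥0} {v : Z → X} (hσ : Continuous σ) (hv : Continuous v) :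
    Continuous fun s => T.op (σ s) (v s) := by
  rw [continuous_iff_continuousAt]
  intro s₀
  obtain ⟨M, -, hM⟩ := T.exists_norm_op_le (σ s₀ + 1)
  have h1 : Tendsto (fun s => T.op (σ s) (v s - v s₀)) (𝓝 s₀) (𝓝 0) := by
    rw [tendsto_zero_iff_norm_tendsto_zero]
    have h2 : Tendsto (fun s => M * ‖v s - v s₀‖) (𝓝 s₀) (𝓝 0) := by
      simpa using ((hv.tendsto s₀).sub_const (v s₀)).norm.const_mul M
    refine squeeze_zero' (Eventually.of_forall fun s => norm_nonneg _) ?_ h2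
    have : Iic (σ s₀ + 1) ∈ 𝓝 (σ s₀) := Iic_mem_nhds (lt_add_of_pos_right _ one_pos)
    filter_upwards [hσ.tendsto s₀ this] with s hs
    exact ((T.op _).le_opNorm _).trans (by gcongr; exact hM _ hs)
  have h3 := h1.add (((T.continuous_op (v s₀)).comp hσ).tendsto s₀)
  rw [ContinuousAt]
  simpa [map_sub] using h3

theorem tendsto_coe_nhdsGT_zero :
    Tendsto (fun h : ℝ≥0 => (h : ℝ)) (𝓝[>] 0) (𝓝[>] 0) :=
  tendsto_nhdsWithin_iff.2 ⟨(NNReal.continuous_coe.tendsto 0).mono_left nhdsWithin_le_nhds, by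
    filter_upwards [self_mem_nhdsWithin] with h hh
    exact NNReal.coe_pos.2 hh⟩

theorem tendsto_toNNReal_nhdsGT_zero :
    Tendsto Real.toNNReal (𝓝[>] 0) (𝓝[>] 0) :=
  tendsto_nhdsWithin_iff.2 ⟨by
    have := (continuous_real_toNNReal.tendsto 0).mono_left (nhdsWithin_le_nhds (s := Ioi 0))
    rwa [Real.toNNReal_zero] at this, by
    filter_upwards [self_mem_nhdsWithin] with h hh
    exact Real.toNNReal_pos.2 hh⟩

/-- A function with derivative `y` at `r` has right difference quotients tending to `y`. -/
theorem tendsto_quotient_of_hasDerivAt {f : ℝ → X} {r : ℝ} {y : X}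
    (hf : letI : NormedSpace ℝ X := NormedSpace.restrictScalars ℝ 𝕜 X
      HasDerivAt f y r) :
    Tendsto (fun h : ℝ≥0 => ((h : ℝ) : 𝕜)⁻¹ • (f (r + h) - f r)) (𝓝[>] 0) (𝓝 y) := by
  let _ : NormedSpace ℝ X := NormedSpace.restrictScalars ℝ 𝕜 X
  have hsm : ∀ (a : ℝ) (x : X), (a : 𝕜) • x = a • x := fun a x => rfl
  have h1 := hasDerivAt_iff_tendsto_slope_zero.1 hf
  have h2 := tendsto_coe_nhdsGT_zero.mono_right
    (nhdsWithin_mono (0 : ℝ) fun x (hx : 0 < x) => hx.ne')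
  refine (h1.comp h2).congr fun h => ?_
  rw [← RCLike.ofReal_inv, hsm]
  rfl

/-! ### Domain and kernel of the generator -/

/-- The integral `∫₀ᵗ T(s) x ds` lies in the domain, with image `T(t) x - x`. -/
theorem exists_hasGen_op_sub [CompleteSpace X] (T : C0Semigroup 𝕜 X) (t : ℝ≥0) (x : X) :
    ∃ m, T.HasGen m (T.op t x - x) := by
  let _ : NormedSpace ℝ X := NormedSpace.restrictScalars ℝ 𝕜 X
  set g : ℝ → X := fun s => T.op s.toNNReal x with hg
  have hgc : Continuous g := (T.continuous_op x).comp continuous_real_toNNReal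
  set F : ℝ → X := fun r => ∫ s in (0 : ℝ)..r, g s with hF
  have hF0 : F 0 = 0 := by simp [hF]
  have hFd : ∀ r, HasDerivAt F (g r) r := fun r =>
    intervalIntegral.integral_hasDerivAt_right (hgc.intervalIntegrable _ _)
      (hgc.stronglyMeasurableAtFilter _ _) hgc.continuousAt
  have hlim : ∀ r, Tendsto (fun h : ℝ≥0 => ((h : ℝ) : 𝕜)⁻¹ • (F (r + h) - F r)) (𝓝[>] 0)
      (𝓝 (g r)) := fun r => tendsto_quotient_of_hasDerivAt (hFd r)
  have h0 : T.op t x - x = g t - g 0 := by simp [hg, T.op_zero]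
  refine ⟨F t, ?_⟩
  rw [h0]
  refine ((hlim t).sub (hlim 0)).congr fun h => ?_
  rw [← smul_sub, hF0, sub_zero, zero_add]
  congr 1
  have e1 : T.op h (F t) = ∫ s in (0 : ℝ)..t, T.op h (g s) :=
    (((T.op h).restrictScalars ℝ).intervalIntegral_comp_comm
      (hgc.intervalIntegrable _ _)).symm
  have e2 : ∫ s in (0 : ℝ)..t, T.op h (g s) = ∫ s in (0 : ℝ)..t, g (s + h) := by
    refine intervalIntegral.integral_congr fun s hs => ?_
    rw [uIcc_of_le (show (0 : ℝ) ≤ t from t.2)] at hs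
    simp only [hg]
    rw [Real.toNNReal_add hs.1 (NNReal.coe_nonneg h), Real.toNNReal_coe, add_comm, op_add_apply]
  have e3 : T.op h (F t) = F (t + h) - F h := by
    rw [e1, e2, intervalIntegral.integral_comp_add_right, zero_add, hF]
    exact (intervalIntegral.integral_interval_sub_left (hgc.intervalIntegrable _ _)
      (hgc.intervalIntegrable _ _)).symm
  rw [e3]
  abel

/-- Elements of the kernel of the generator are fixed by the semigroup. -/
theorem HasGen.op_eq_of_zero {T : C0Semigroup 𝕜 X} {x : X} (h : T.HasGen x 0) (t : ℝ≥0) :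
    T.op t x = x := by
  let _ : NormedSpace ℝ X := NormedSpace.restrictScalars ℝ 𝕜 X
  have hsm : ∀ (a : ℝ) (x : X), (a : 𝕜) • x = a • x := fun a x => rfl
  set g : ℝ → X := fun s => T.op s.toNNReal x with hg
  have hgc : Continuous g := (T.continuous_op x).comp continuous_real_toNNReal
  -- Only right derivatives are available, since `T` runs forward in time; a continuous function
  -- with zero right derivative is still constant.
  have hd : ∀ r ∈ Ico (0 : ℝ) t, HasDerivWithinAt g 0 (Ici r) r := by
    intro r hr
    have h1 := h.apply r.toNNReal
    rw [map_zero] at h1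
    rw [← hasDerivWithinAt_Ioi_iff_Ici, hasDerivWithinAt_iff_tendsto_slope' (by simp)]
    have h2 : Tendsto (fun y : ℝ => (y - r).toNNReal) (𝓝[>] r) (𝓝[>] 0) := by
      refine tendsto_toNNReal_nhdsGT_zero.comp (tendsto_nhdsWithin_iff.2 ⟨?_, ?_⟩)
      · have : Continuous fun y : ℝ => y - r := by fun_prop
        simpa using (this.tendsto r).mono_left (nhdsWithin_le_nhds (s := Ioi r))
      · filter_upwards [self_mem_nhdsWithin] with y hy using sub_pos.2 (mem_Ioi.1 hy)
    refine (h1.comp h2).congr' ?_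
    filter_upwards [self_mem_nhdsWithin] with y hy
    have hy' : 0 ≤ y - r := sub_nonneg.2 (le_of_lt hy)
    rw [Function.comp_apply, ← op_add_apply, ← Real.toNNReal_add hy' hr.1, sub_add_cancel,
      Real.coe_toNNReal _ hy', ← RCLike.ofReal_inv, hsm]
    rfl
  have := constant_of_has_deriv_right_zero hgc.continuousOn hd t ⟨t.2, le_rfl⟩
  simpa [hg, T.op_zero] using this

/-! ### Rescaling and a criterion for exponential stability -/

/-- The rescaled semigroup `e^{-ct} T(t)`. -/
def rescale (T : C0Semigroup 𝕜 X) (c : ℝ) : C0Semigroup 𝕜 X where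
  op t := ((Real.exp (-c * t) : ℝ) : 𝕜) • T.op t
  op_zero := by simp [T.op_zero]
  op_add s t := by
    ext x
    simp only [_root_.smul_apply, ContinuousLinearMap.comp_apply, map_smul,
      op_add_apply, smul_smul]
    rw [← RCLike.ofReal_mul, ← Real.exp_add]
    congr 3
    push_cast
    ring
  continuous_op x := by
    have h : Continuous fun t : ℝ≥0 => ((Real.exp (-c * t) : ℝ) : 𝕜) := by fun_prop
    exact h.smul (T.continuous_op x)

theorem rescale_op_apply (T : C0Semigroup 𝕜 X) (c : ℝ) (t : ℝ≥0) (x : X) :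
    (T.rescale c).op t x = ((Real.exp (-c * t) : ℝ) : 𝕜) • T.op t x := rfl

theorem norm_rescale_op (T : C0Semigroup 𝕜 X) (c : ℝ) (t : ℝ≥0) :
    ‖(T.rescale c).op t‖ = Real.exp (-c * t) * ‖T.op t‖ := by
  change ‖((Real.exp (-c * t) : ℝ) : 𝕜) • T.op t‖ = _
  rw [norm_smul, RCLike.norm_ofReal, abs_of_pos (Real.exp_pos _)]

theorem tendsto_exp_quotient (c : ℝ) :
    Tendsto (fun h : ℝ≥0 => ((h : ℝ) : 𝕜)⁻¹ * (((Real.exp (-c * h) : ℝ) : 𝕜) - 1)) (𝓝[>] 0)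
      (𝓝 (-c : ℝ)) := by
  have h1 : HasDerivAt (fun h : ℝ => Real.exp (-c * h)) (-c) 0 := by
    have := ((hasDerivAt_id (0 : ℝ)).const_mul (-c)).exp
    simpa using this
  have h2 := hasDerivAt_iff_tendsto_slope_zero.1 h1
  have h3 := h2.comp (tendsto_coe_nhdsGT_zero.mono_right
    (nhdsWithin_mono (0 : ℝ) fun x (hx : 0 < x) => hx.ne'))
  refine ((RCLike.continuous_ofReal (K := 𝕜)).tendsto _).comp h3 |>.congr fun h => ?_
  simp

theorem HasGen.rescale {T : C0Semigroup 𝕜 X} {x y : X} (h : T.HasGen x y) (c : ℝ) :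
    (T.rescale c).HasGen x (y - (c : 𝕜) • x) := by
  have h0 : Tendsto (fun h : ℝ≥0 => ((Real.exp (-c * h) : ℝ) : 𝕜)) (𝓝[>] 0) (𝓝 1) := by
    have : Continuous fun t : ℝ≥0 => ((Real.exp (-c * t) : ℝ) : 𝕜) := by fun_prop
    simpa using (this.tendsto 0).mono_left nhdsWithin_le_nhds
  have h2 := (h0.smul h).add ((tendsto_exp_quotient (𝕜 := 𝕜) c).smul_const x)
  have e : y - (c : 𝕜) • x = (1 : 𝕜) • y + ((-c : ℝ) : 𝕜) • x := by
    simp [sub_eq_add_neg]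
  rw [e]
  refine h2.congr fun h => ?_
  rw [rescale_op_apply]
  module

theorem rescale_rescale_neg (T : C0Semigroup 𝕜 X) (c : ℝ) (t : ℝ≥0) (x : X) :
    ((T.rescale c).rescale (-c)).op t x = T.op t x := by
  rw [rescale_op_apply, rescale_op_apply, smul_smul, ← RCLike.ofReal_mul, ← Real.exp_add]
  simp

theorem hasGen_of_rescale {T : C0Semigroup 𝕜 X} {x y : X} {c : ℝ}
    (h : (T.rescale c).HasGen x y) : T.HasGen x (y + (c : 𝕜) • x) := by
  have := h.rescale (-c)
  simp only [HasGen, rescale_rescale_neg] at this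
  simpa [HasGen] using this

/-- A `C₀`-semigroup with `‖T(a)‖ < 1` for some `a > 0` is exponentially stable. -/
theorem expStable_of_norm_lt_one [CompleteSpace X] (T : C0Semigroup 𝕜 X) {a : ℝ≥0} (ha : 0 < a)
    (h : ‖T.op a‖ < 1) : T.ExpStable := by
  obtain ⟨M, hM, hMb⟩ := T.exists_norm_op_le a
  -- The maximum keeps `q` positive, so that `log q` and `q⁻¹` are usable even if `T(a) = 0`.
  set q := max ‖T.op a‖ (1 / 2) with hq
  have hq0 : 0 < q := lt_of_lt_of_le (by norm_num) (le_max_right _ _)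
  have hq1 : q < 1 := max_lt h (by norm_num)
  have hqn : ∀ n : ℕ, ‖T.op (n * a)‖ ≤ 1 * q ^ n := by
    intro n
    induction n with
    | zero => simpa [T.op_zero] using ContinuousLinearMap.norm_id_le
    | succ n ih =>
      have e : ((n + 1 : ℕ) : ℝ≥0) * a = n * a + a := by push_cast; ring
      rw [e, T.op_add, pow_succ, ← mul_assoc]
      exact (ContinuousLinearMap.opNorm_comp_le _ _).trans
        (mul_le_mul ih (le_max_left _ _) (norm_nonneg _) (by positivity))
  have hlog : Real.log q < 0 := Real.log_neg hq0 hq1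
  have ha' : (0 : ℝ) < a := ha
  -- With this rate, `e^{-ωt} = q^{t/a}`. Writing `t = n a + r` with `r ≤ a` gives `‖T(t)‖ ≤ M qⁿ`,
  -- and `t/a < n + 1` turns `qⁿ` into at most `q⁻¹ q^{t/a}`.
  refine ⟨M * q⁻¹, -Real.log q / a, by positivity, div_pos (neg_pos.2 hlog) ha', fun t => ?_⟩
  set n := ⌊(t : ℝ) / a⌋₊ with hn
  have hn1 : (n : ℝ) * a ≤ t := by
    have := Nat.floor_le (show 0 ≤ (t : ℝ) / a by positivity)
    rwa [le_div_iff₀ ha'] at this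
  have hn2 : (t : ℝ) / a < n + 1 := Nat.lt_floor_add_one _
  have hn1' : (n : ℝ≥0) * a ≤ t := by exact_mod_cast hn1
  obtain ⟨r, hr⟩ := exists_add_of_le hn1'
  have hra : r ≤ a := by
    have h1 : (t : ℝ) = n * a + r := by exact_mod_cast hr
    rw [div_lt_iff₀ ha'] at hn2
    have : (r : ℝ) ≤ a := by linarith
    exact_mod_cast this
  have h1 : ‖T.op t‖ ≤ q ^ n * M := by
    rw [hr, T.op_add]
    refine (ContinuousLinearMap.opNorm_comp_le _ _).trans ?_
    have := hqn n
    rw [one_mul] at this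
    exact mul_le_mul this (hMb r hra) (norm_nonneg _) (by positivity)
  refine h1.trans ?_
  have h2 : q ^ (n + 1) ≤ Real.exp (-(-Real.log q / a) * t) := by
    rw [← Real.exp_log (pow_pos hq0 (n + 1)), Real.log_pow]
    apply Real.exp_le_exp.2
    have e : -(-Real.log q / a) * t = (t / a) * Real.log q := by ring
    rw [e]
    push_cast
    exact mul_le_mul_of_nonpos_right hn2.le hlog.le
  calc q ^ n * M = M * q⁻¹ * q ^ (n + 1) := by
        rw [pow_succ]
        field_simp
    _ ≤ _ := by gcongr

/-! ### The semigroup on the extrapolation space and its generator -/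

section Extrapolation

variable (T : C0Semigroup 𝕜 X) (lam : 𝕜) (hlam : lam ∈ T.generator.resolventSet)

theorem denseRange_incl : DenseRange (T.incl lam hlam) :=
  (UniformSpace.Completion.denseRange_coe (α := T.PreExtrap lam hlam)).comp
    (T.toPre lam hlam).surjective.denseRange (UniformSpace.Completion.continuous_coe _)

/-- The resolvent commutes with `T(t)`, so the bound holds on the dense copy of `X`. -/
theorem norm_extrapOp_le (t : ℝ≥0) : ‖T.extrapOp lam hlam t‖ ≤ ‖T.op t‖ := by
  refine ContinuousLinearMap.opNorm_le_bound _ (norm_nonneg _) fun x => ?_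
  refine (T.denseRange_incl lam hlam).induction_on (p := fun x =>
    ‖T.extrapOp lam hlam t x‖ ≤ ‖T.op t‖ * ‖x‖) x ?_ fun y => ?_
  · exact isClosed_le (by fun_prop) (by fun_prop)
  · rw [extrapOp_incl, norm_incl, norm_incl, resolventOp_op]
    exact (T.op t).le_opNorm _

/-- The extension of `T` to the extrapolation space is a `C₀`-semigroup. -/
def extrapSemigroup [CompleteSpace X] : C0Semigroup 𝕜 (T.Extrap lam hlam) :=
  ofDense (T.extrapOp lam hlam)
    (by
      ext x
      refine (T.denseRange_incl lam hlam).induction_on (p := fun x =>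
        T.extrapOp lam hlam 0 x = x) x (isClosed_eq (by fun_prop) (by fun_prop)) fun y => ?_
      rw [extrapOp_incl, op_zero_apply])
    (by
      intro s t
      ext x
      refine (T.denseRange_incl lam hlam).induction_on (p := fun x =>
        T.extrapOp lam hlam (s + t) x = T.extrapOp lam hlam s (T.extrapOp lam hlam t x)) x
        (isClosed_eq (by fun_prop) (by fun_prop)) fun y => ?_
      rw [extrapOp_incl, extrapOp_incl, extrapOp_incl, op_add_apply])
    1 one_pos (T.exists_norm_op_le 1).choose
    (fun t ht => (T.norm_extrapOp_le lam hlam t).trans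
      ((T.exists_norm_op_le 1).choose_spec.2 t ht))
    (range (T.incl lam hlam)) (T.denseRange_incl lam hlam)
    (by
      rintro _ ⟨x, rfl⟩
      simp only [extrapOp_incl]
      have := (T.continuous_op x).tendsto 0
      rw [op_zero_apply] at this
      exact ((T.incl lam hlam).continuous.tendsto x).comp this)

theorem extrapSemigroup_op [CompleteSpace X] (t : ℝ≥0) :
    (T.extrapSemigroup lam hlam).op t = T.extrapOp lam hlam t := rfl

/-- The resolvent extends to an isometry from the extrapolation space to `X`. -/
theorem exists_extension_resolventOp [CompleteSpace X] :
    ∃ R : T.Extrap lam hlam →L[𝕜] X, (∀ x, R (T.incl lam hlam x) = T.resolventOp lam hlam x) ∧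
      Isometry R := by
  have hd := T.denseRange_incl lam hlam
  have hn : ∀ x : X, ‖(T.resolventOp lam hlam : X →ₗ[𝕜] X) x‖ ≤
      1 * ‖(T.incl lam hlam : X →ₗ[𝕜] T.Extrap lam hlam) x‖ := fun x => by
    rw [one_mul]
    exact (T.norm_incl lam hlam x).ge
  set R := (T.resolventOp lam hlam : X →ₗ[𝕜] X).extendOfNorm
    (T.incl lam hlam : X →ₗ[𝕜] T.Extrap lam hlam) with hR
  have hRi : ∀ x, R (T.incl lam hlam x) = T.resolventOp lam hlam x := fun x =>
    LinearMap.extendOfNorm_eq hd ⟨1, hn⟩ x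
  refine ⟨R, hRi, AddMonoidHomClass.isometry_of_norm R fun x => ?_⟩
  refine hd.induction_on (p := fun x => ‖R x‖ = ‖x‖) x
    (isClosed_eq (by fun_prop) (by fun_prop)) fun y => ?_
  rw [hRi, norm_incl]

/-- On `D(A)` this is the left-inverse property of the resolvent; both sides are continuous in `x`
and `D(A)` is dense. -/
theorem extension_extrapGen [CompleteSpace X] {R : T.Extrap lam hlam →L[𝕜] X}
    (hR : ∀ x, R (T.incl lam hlam x) = T.resolventOp lam hlam x) (x : X) :
    R (T.extrapGen lam hlam x) = lam • T.resolventOp lam hlam x - x := by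
  have hd : DenseRange ((↑) : T.generator.domain → X) := by
    simpa [DenseRange] using T.dense_domain
  refine hd.induction_on (p := fun x =>
    R (T.extrapGen lam hlam x) = lam • T.resolventOp lam hlam x - x) x
    (isClosed_eq (by fun_prop) (by fun_prop)) fun y => ?_
  rw [extrapGen_apply, hR]
  have := (T.isResolvent_resolventOp lam hlam).2 y
  rw [map_sub, map_smul] at this
  rw [eq_sub_iff_add_eq', ← eq_sub_iff_add_eq]
  exact this.symm

theorem hasGen_resolventOp (x : X) :
    T.HasGen (T.resolventOp lam hlam x) (lam • T.resolventOp lam hlam x - x) := by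
  obtain ⟨h, e⟩ := (T.isResolvent_resolventOp lam hlam).1 x
  refine T.hasGen_iff_mem.2 ⟨h, ?_⟩
  rw [eq_sub_iff_add_eq', ← eq_sub_iff_add_eq]
  exact e.symm

/-- On the extrapolation space, the generator is the extension of `A`, with domain `X`. -/
theorem hasGen_extrapSemigroup [CompleteSpace X] (x : X) :
    (T.extrapSemigroup lam hlam).HasGen (T.incl lam hlam x) (T.extrapGen lam hlam x) := by
  obtain ⟨R, hR, hiso⟩ := T.exists_extension_resolventOp lam hlam
  -- The isometry transports the limit to `X`, where it becomes the derivative of the orbit of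
  -- `R(lam, A) x`, an element of `D(A)`.
  rw [HasGen, hiso.isEmbedding.isInducing.tendsto_nhds_iff, T.extension_extrapGen lam hlam hR]
  refine (T.hasGen_resolventOp lam hlam x).congr fun h => ?_
  rw [Function.comp_apply, map_smul, map_sub, extrapSemigroup_op, extrapOp_incl, hR, hR,
    resolventOp_op]

theorem hasGen_of_extrapGen_eq [CompleteSpace X] {x z : X}
    (h : T.extrapGen lam hlam x = T.incl lam hlam z) : T.HasGen x z := by
  obtain ⟨R, hR, -⟩ := T.exists_extension_resolventOp lam hlam
  have e := T.extension_extrapGen lam hlam hR x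
  rw [h, hR] at e
  -- This exhibits `x` in the range of the resolvent, which is contained in `D(A)`.
  have e1 : T.resolventOp lam hlam (lam • x - z) = x := by
    rw [map_sub, map_smul, e]
    abel
  have := T.hasGen_resolventOp lam hlam (lam • x - z)
  rw [e1] at this
  simpa using this

end Extrapolation

variable {Y : Type*} [NormedAddCommGroup Y] [NormedSpace 𝕜 Y]
variable {U : Type*} [NormedAddCommGroup U] [NormedSpace 𝕜 U]

/-! ### Outputs of initial states in the domain -/

section Observation

variable (S : C0Semigroup 𝕜 Y) (C : S.generator.domain →ₗ[𝕜] U)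

/-- The output `s ↦ C S(s) g` of the initial state `g ∈ D(𝐀)`. -/
def output (g : S.generator.domain) (s : ℝ) : U :=
  C ⟨S.op s.toNNReal (g : Y), S.op_mem_domain s.toNNReal g⟩

variable {S C}

theorem output_zero (g : S.generator.domain) : S.output C g 0 = C g := by
  rw [output]
  congr
  rw [Real.toNNReal_zero, op_zero_apply]

theorem output_op (g : S.generator.domain) (t : ℝ≥0) {s : ℝ} (hs : 0 ≤ s) :
    S.output C ⟨S.op t g, S.op_mem_domain t g⟩ s = S.output C g (s + t) := by
  rw [output, output]
  congr 2
  rw [Real.toNNReal_add hs (NNReal.coe_nonneg t), Real.toNNReal_coe, op_add_apply]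

theorem output_add (g h : S.generator.domain) (s : ℝ) :
    S.output C (g + h) s = S.output C g s + S.output C h s := by
  rw [output, output, output, ← map_add]
  congr 1
  exact Subtype.ext (map_add (S.op s.toNNReal) (g : Y) h)

theorem output_smul (c : 𝕜) (g : S.generator.domain) (s : ℝ) :
    S.output C (c • g) s = c • S.output C g s := by
  rw [output, output, ← map_smul]
  congr 1
  exact Subtype.ext (map_smul (S.op s.toNNReal) c (g : Y))

/-- Since `𝐀` commutes with the semigroup, the orbit of `g ∈ D(𝐀)` is continuous in the graph norm,
for which `C` is bounded. -/
theorem continuous_output (hC : S.generator.GraphBounded C) (g : S.generator.domain) :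
    Continuous (S.output C g) := by
  obtain ⟨c, hc⟩ := hC
  rw [continuous_iff_continuousAt]
  intro s₀
  rw [ContinuousAt, tendsto_iff_norm_sub_tendsto_zero]
  have h1 : Continuous fun s : ℝ => c * (‖S.op s.toNNReal (g : Y) - S.op s₀.toNNReal (g : Y)‖ +
      ‖S.op s.toNNReal (S.generator g) - S.op s₀.toNNReal (S.generator g)‖) := by
    have e1 := (S.continuous_op g).comp continuous_real_toNNReal
    have e2 := (S.continuous_op (S.generator g)).comp continuous_real_toNNReal
    simp only [Function.comp_def] at e1 e2
    fun_prop
  have h2 := h1.tendsto s₀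
  simp only [sub_self, norm_zero, add_zero, mul_zero] at h2
  refine squeeze_zero (fun s => norm_nonneg _) (fun s => ?_) h2
  rw [output, output, ← map_sub]
  refine (hc _).trans (le_of_eq ?_)
  rw [LinearPMap.map_sub, generator_op, generator_op]
  rfl

end Observation

/-! ### The control integral -/

section Control

variable {T : C0Semigroup 𝕜 X} {lam : 𝕜} {hlam : lam ∈ T.generator.resolventSet}
variable {B : U →L[𝕜] T.Extrap lam hlam}

theorem controlInt_eq [CompleteSpace X] (t : ℝ) (u : ℝ → U) :
    T.controlInt lam hlam B t u =
      letI : NormedSpace ℝ (T.Extrap lam hlam) := NormedSpace.restrictScalars ℝ 𝕜 _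
      ∫ s in (0 : ℝ)..t, (T.extrapSemigroup lam hlam).op (t - s).toNNReal (B (u s)) := rfl

theorem controlInt_congr {t : ℝ} (ht : 0 ≤ t) {u v : ℝ → U} (h : ∀ s ∈ Icc 0 t, u s = v s) :
    T.controlInt lam hlam B t u = T.controlInt lam hlam B t v := by
  let _ : NormedSpace ℝ (T.Extrap lam hlam) := NormedSpace.restrictScalars ℝ 𝕜 _
  refine intervalIntegral.integral_congr fun s hs => ?_
  rw [uIcc_of_le ht] at hs
  simp only [h s hs]

theorem continuous_controlInt_integrand [CompleteSpace X] (t : ℝ) {u : ℝ → U}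
    (hu : Continuous u) :
    Continuous fun s => (T.extrapSemigroup lam hlam).op (t - s).toNNReal (B (u s)) :=
  continuous_op_apply _ (by fun_prop) (by fun_prop)

theorem controlInt_add_fun [CompleteSpace X] (t : ℝ) {u v : ℝ → U}
    (hu : Continuous u) (hv : Continuous v) :
    T.controlInt lam hlam B t (fun s => u s + v s) =
      T.controlInt lam hlam B t u + T.controlInt lam hlam B t v := by
  let _ : NormedSpace ℝ (T.Extrap lam hlam) := NormedSpace.restrictScalars ℝ 𝕜 _
  rw [controlInt_eq, controlInt_eq, controlInt_eq]
  rw [← intervalIntegral.integral_add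
    ((continuous_controlInt_integrand t hu).intervalIntegrable _ _)
    ((continuous_controlInt_integrand t hv).intervalIntegrable _ _)]
  simp only [map_add]

theorem controlInt_smul_fun [CompleteSpace X] (t : ℝ) (c : 𝕜) (u : ℝ → U) :
    T.controlInt lam hlam B t (fun s => c • u s) = c • T.controlInt lam hlam B t u := by
  let _ : NormedSpace ℝ (T.Extrap lam hlam) := NormedSpace.restrictScalars ℝ 𝕜 _
  rw [controlInt_eq, controlInt_eq]
  simp only [map_smul]
  exact intervalIntegral.integral_smul c _

/-- The composition property of the control integral. -/
theorem controlInt_add_time [CompleteSpace X] (t s : ℝ≥0) {u : ℝ → U} (hu : Continuous u) :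
    T.controlInt lam hlam B (t + s : ℝ≥0) u =
      T.extrapOp lam hlam t (T.controlInt lam hlam B s u) +
        T.controlInt lam hlam B t (fun r => u (r + s)) := by
  let _ : NormedSpace ℝ (T.Extrap lam hlam) := NormedSpace.restrictScalars ℝ 𝕜 _
  have hi := fun t : ℝ => continuous_controlInt_integrand (T := T) (B := B) t hu
  -- Split at `s`: the operator at time `t` factors out of the part over `[0, s]`, and the part over
  -- `[s, t + s]` is translated back by `s`.
  rw [controlInt_eq, controlInt_eq, controlInt_eq,
    ← intervalIntegral.integral_add_adjacent_intervals
      ((hi _).intervalIntegrable 0 s) ((hi _).intervalIntegrable s _)]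
  congr 1
  · rw [← extrapSemigroup_op]
    have e := (((T.extrapSemigroup lam hlam).op t).restrictScalars ℝ).intervalIntegral_comp_comm
      ((hi s).intervalIntegrable (μ := volume) 0 s)
    refine Eq.trans (intervalIntegral.integral_congr fun r hr => ?_) e
    rw [uIcc_of_le (show (0 : ℝ) ≤ s from s.2)] at hr
    have e2 : ((t + s : ℝ≥0) - r : ℝ).toNNReal = t + (s - r : ℝ).toNNReal := by
      rw [NNReal.coe_add, add_sub_assoc, Real.toNNReal_add (NNReal.coe_nonneg t) (sub_nonneg.2 hr.2),
        Real.toNNReal_coe]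
    simp only [e2, op_add_apply]
    rfl
  · have e := intervalIntegral.integral_comp_add_right (a := 0) (b := (t : ℝ))
      (fun r => (T.extrapSemigroup lam hlam).op ((t + s : ℝ≥0) - r : ℝ).toNNReal (B (u r))) (s : ℝ)
    rw [zero_add, ← NNReal.coe_add] at e
    rw [← e]
    simp only [NNReal.coe_add, add_sub_add_right_eq_sub]

/-- Delaying a function by `d` and extending it by zero. -/
theorem integral_indicator_delay {Z : Type*} [NormedAddCommGroup Z] [NormedSpace ℝ Z]
    (F : ℝ → Z) {d t : ℝ} (hd : 0 ≤ d) (hdt : d ≤ t) :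
    ∫ s in (0 : ℝ)..t, (Ioi d).indicator (fun s => F (s - d)) s = ∫ s in (0 : ℝ)..(t - d), F s := by
  rw [intervalIntegral.integral_of_le (hd.trans hdt), setIntegral_indicator measurableSet_Ioi,
    Ioc_inter_Ioi, sup_of_le_right hd, ← intervalIntegral.integral_of_le hdt,
    intervalIntegral.integral_comp_sub_right, sub_self]

/-- The delayed input may jump at `d`, but it is bounded on bounded intervals; this is where inputs
in `L²_loc` that are not continuous are needed. -/
theorem locSqIntegrable_indicator_delay {u : ℝ → U} (hu : Continuous u) (d : ℝ) :
    LocSqIntegrable ((Ioi d).indicator fun s => u (s - d)) := by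
  intro τ hτ
  refine MemLp.indicator measurableSet_Ioi ?_
  have hc : Continuous fun s => u (s - d) := by fun_prop
  obtain ⟨M, hM⟩ := isCompact_Icc.exists_bound_of_continuousOn (s := Icc 0 τ) hc.continuousOn
  refine MemLp.of_bound hc.aestronglyMeasurable M ?_
  filter_upwards [ae_restrict_mem measurableSet_Ioc] with s hs
  exact hM s (Ioc_subset_Icc_self hs)

/-- An admissible control operator is admissible for all shorter times. -/
theorem AdmissibleControl.exists_short [CompleteSpace X] (hB : T.AdmissibleControl lam hlam B) :
    ∃ t₀ K : ℝ, 0 < t₀ ∧ 0 ≤ K ∧ ∀ t, 0 ≤ t → t ≤ t₀ → ∀ u : ℝ → U, Continuous u →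
      ∃ z : X, T.incl lam hlam z = T.controlInt lam hlam B t u ∧
        ‖z‖ ≤ K * √(∫ s in (0 : ℝ)..t, ‖u s‖ ^ 2) := by
  let _ : NormedSpace ℝ (T.Extrap lam hlam) := NormedSpace.restrictScalars ℝ 𝕜 _
  obtain ⟨t₀, K, ht₀, hK, h⟩ := hB
  refine ⟨t₀, K, ht₀, hK, fun t ht htt u hu => ?_⟩
  -- Let the input vanish until time `t₀ - t` and then run `u`. At time `t₀` this has the same
  -- control integral and `L²` norm as `u` at time `t`, so `K` does not depend on `t`.
  obtain ⟨z, hz, hzn⟩ := h _ (locSqIntegrable_indicator_delay hu (t₀ - t))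
  have hd : 0 ≤ t₀ - t := sub_nonneg.2 htt
  have hd' : t₀ - t ≤ t₀ := by linarith
  refine ⟨z, hz.trans ?_, hzn.trans (le_of_eq ?_)⟩
  · have e := integral_indicator_delay
      (fun s => (T.extrapSemigroup lam hlam).op (t - s).toNNReal (B (u s))) hd hd'
    rw [sub_sub_cancel] at e
    rw [controlInt_eq, controlInt_eq, ← e]
    congr 1
    ext s
    by_cases hs : s ∈ Ioi (t₀ - t)
    · rw [indicator_of_mem hs, indicator_of_mem hs]
      congr 3
      ring
    · rw [indicator_of_notMem hs, indicator_of_notMem hs, map_zero, map_zero]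
  · have e := integral_indicator_delay (fun s => ‖u s‖ ^ 2) hd hd'
    rw [sub_sub_cancel] at e
    rw [← e]
    congr 3
    ext s
    by_cases hs : s ∈ Ioi (t₀ - t)
    · rw [indicator_of_mem hs, indicator_of_mem hs]
    · rw [indicator_of_notMem hs, indicator_of_notMem hs, norm_zero]
      simp

/-- The time average of the control integral tends to `B u(0)` as the time tends to zero. -/
theorem tendsto_average_controlInt [CompleteSpace X] {u : ℝ → U} (hu : Continuous u) :
    Tendsto (fun h : ℝ≥0 => ((h : ℝ) : 𝕜)⁻¹ • T.controlInt lam hlam B h u) (𝓝[>] 0)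
      (𝓝 (B (u 0))) := by
  let _ : NormedSpace ℝ (T.Extrap lam hlam) := NormedSpace.restrictScalars ℝ 𝕜 _
  have hG : Continuous fun p : ℝ × ℝ =>
      (T.extrapSemigroup lam hlam).op (p.1 - p.2).toNNReal (B (u p.2)) :=
    continuous_op_apply _ (by fun_prop) (by fun_prop)
  rw [Metric.tendsto_nhds]
  intro ε hε
  -- Joint continuity at the origin makes the integrand uniformly close to `B u(0)` for all `0 < s ≤
  -- t < δ`.
  obtain ⟨δ, hδ, h⟩ := Metric.continuousAt_iff.1 (hG.continuousAt (x := (0, 0))) (ε / 2)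
    (by positivity)
  have hδ' : 0 < δ.toNNReal := Real.toNNReal_pos.2 hδ
  filter_upwards [self_mem_nhdsWithin, mem_nhdsWithin_of_mem_nhds (Iio_mem_nhds hδ')] with t ht htδ
  have ht0 : (0 : ℝ) < t := ht
  have htδ' : (t : ℝ) < δ := Real.lt_toNNReal_iff_coe_lt.1 htδ
  have hi := continuous_controlInt_integrand (T := T) (B := B) t hu
  have hsub : T.controlInt lam hlam B t u - (t : ℝ) • B (u 0) =
      ∫ s in (0 : ℝ)..t,
        ((T.extrapSemigroup lam hlam).op (t - s : ℝ).toNNReal (B (u s)) - B (u 0)) := by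
    rw [intervalIntegral.integral_sub (hi.intervalIntegrable _ _) (by simp),
      intervalIntegral.integral_const, sub_zero, controlInt_eq]
  have hle : ‖T.controlInt lam hlam B t u - (t : ℝ) • B (u 0)‖ ≤ ε / 2 * |(t : ℝ) - 0| := by
    rw [hsub]
    refine intervalIntegral.norm_integral_le_of_norm_le_const fun s hs => ?_
    rw [uIoc_of_le ht0.le] at hs
    have := @h (t, s) (by
      rw [Prod.dist_eq, max_lt_iff]
      simp only [dist_zero_right, Real.norm_eq_abs]
      rw [abs_of_pos ht0, abs_of_pos hs.1]
      exact ⟨htδ', hs.2.trans_lt htδ'⟩)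
    simp only [dist_eq_norm, sub_self, Real.toNNReal_zero, op_zero_apply] at this
    exact this.le
  have e : ((t : ℝ) : 𝕜)⁻¹ • T.controlInt lam hlam B t u - B (u 0) =
      ((t : ℝ) : 𝕜)⁻¹ • (T.controlInt lam hlam B t u - (t : ℝ) • B (u 0)) := by
    have e1 : (t : ℝ) • B (u 0) = ((t : ℝ) : 𝕜) • B (u 0) := rfl
    rw [e1, smul_sub, inv_smul_smul₀]
    exact_mod_cast ht0.ne'
  rw [dist_eq_norm, e, norm_smul, norm_inv, RCLike.norm_ofReal, abs_of_pos ht0]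
  rw [sub_zero, abs_of_pos ht0] at hle
  calc (t : ℝ)⁻¹ * _ ≤ (t : ℝ)⁻¹ * (ε / 2 * t) := by gcongr
    _ = ε / 2 := by field_simp
    _ < ε := by linarith

end Control

/-! ### The off-diagonal operators -/

section Coupling

variable {T : C0Semigroup 𝕜 X} {lam : 𝕜} {hlam : lam ∈ T.generator.resolventSet}
variable {B : U →L[𝕜] T.Extrap lam hlam}
variable {S : C0Semigroup 𝕜 Y} {C : S.generator.domain →ₗ[𝕜] U}

theorem controlInt_output_add [CompleteSpace X] (hC : S.generator.GraphBounded C)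
    (t s : ℝ≥0) (g : S.generator.domain) :
    T.controlInt lam hlam B (t + s : ℝ≥0) (S.output C g) =
      T.extrapOp lam hlam t (T.controlInt lam hlam B s (S.output C g)) +
        T.controlInt lam hlam B t (S.output C ⟨S.op s g, S.op_mem_domain s g⟩) := by
  rw [controlInt_add_time t s (continuous_output hC g)]
  congr 1
  exact controlInt_congr t.2 fun r hr => (output_op g s hr.1).symm

/-- The two admissibility estimates are chained up to the smaller of their times. The first bound
tends to zero with `t` for fixed `g`; the second is uniform in `g` and allows extension by density.
-/
theorem exists_short_coupling [CompleteSpace X] (hB : T.AdmissibleControl lam hlam B)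
    (hCb : S.generator.GraphBounded C) (hC : S.AdmissibleObservation C) :
    ∃ τ : ℝ≥0, 0 < τ ∧ ∃ K L : ℝ, ∀ t ≤ τ, ∀ g : S.generator.domain,
      ∃ z : X, T.incl lam hlam z = T.controlInt lam hlam B t (S.output C g) ∧
        ‖z‖ ≤ K * √(∫ s in (0 : ℝ)..t, ‖S.output C g s‖ ^ 2) ∧ ‖z‖ ≤ L * ‖(g : Y)‖ := by
  obtain ⟨t₀, K, ht₀, hK, h⟩ := hB.exists_short
  obtain ⟨t₁, L, ht₁, hL, h'⟩ := hC
  refine ⟨(min t₀ t₁).toNNReal, Real.toNNReal_pos.2 (lt_min ht₀ ht₁), K, K * L,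
    fun t ht g => ?_⟩
  have ht' : (t : ℝ) ≤ min t₀ t₁ := (Real.le_toNNReal_iff_coe_le (lt_min ht₀ ht₁).le).1 ht
  obtain ⟨z, hz, hzn⟩ := h t t.2 (ht'.trans (min_le_left _ _)) _ (continuous_output hCb g)
  refine ⟨z, hz, hzn, hzn.trans ?_⟩
  rw [mul_assoc]
  gcongr
  refine Real.sqrt_le_iff.2 ⟨by positivity, ?_⟩
  rw [mul_pow]
  refine le_trans ?_ (h' g)
  refine intervalIntegral.integral_mono_interval le_rfl t.2 (ht'.trans (min_le_right _ _))
    (Eventually.of_forall fun s => by positivity) ?_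
  exact ((continuous_output hCb g).norm.pow 2).intervalIntegrable _ _

/-- The operators `g ↦ ∫₀ᵗ T(t-s) B C S(s) g ds` take values in `X` and are bounded for the norm of
`Y`, so they extend to `Y`. -/
theorem exists_coupling [CompleteSpace X] [CompleteSpace Y] (hB : T.AdmissibleControl lam hlam B)
    (hCb : S.generator.GraphBounded C) (hC : S.AdmissibleObservation C) :
    ∃ W : ℝ≥0 → Y →L[𝕜] X, ∀ t (g : S.generator.domain),
      T.incl lam hlam (W t g) = T.controlInt lam hlam B t (S.output C g) := by
  obtain ⟨τ, hτ, K, L, h⟩ := exists_short_coupling hB hCb hC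
  have hbd : ∀ t : ℝ≥0, ∃ M, ∀ g : S.generator.domain,
      ∃ z : X, T.incl lam hlam z = T.controlInt lam hlam B t (S.output C g) ∧
        ‖z‖ ≤ M * ‖(g : Y)‖ := by
    intro t
    -- Induction on the number of steps of length `τ` needed to cover `[0, t]`.
    obtain ⟨n, hn⟩ := exists_nat_ge (t / τ)
    rw [div_le_iff₀ hτ] at hn
    induction n generalizing t with
    | zero =>
      refine ⟨L, fun g => ?_⟩
      obtain ⟨z, hz, -, hzn⟩ := h t (hn.trans (by simp)) g
      exact ⟨z, hz, hzn⟩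
    | succ n ih =>
      rcases le_total t τ with ht | ht
      · refine ⟨L, fun g => ?_⟩
        obtain ⟨z, hz, -, hzn⟩ := h t ht g
        exact ⟨z, hz, hzn⟩
      · obtain ⟨s, rfl⟩ := exists_add_of_le ht
        have hs : s ≤ n * τ := by
          have : τ + s ≤ τ + n * τ := hn.trans (le_of_eq (by push_cast; ring))
          exact le_of_add_le_add_left this
        obtain ⟨M, hM⟩ := ih s hs
        refine ⟨‖T.op τ‖ * M + |L| * ‖S.op s‖, fun g => ?_⟩
        obtain ⟨z, hz, hzn⟩ := hM g
        obtain ⟨w, hw, -, hwn⟩ := h τ le_rfl ⟨S.op s g, S.op_mem_domain s g⟩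
        refine ⟨T.op τ z + w, ?_, ?_⟩
        · rw [controlInt_output_add hCb, map_add, ← extrapOp_incl, hz, hw]
        · refine (norm_add_le _ _).trans ?_
          rw [add_mul]
          refine add_le_add ?_ ?_
          · rw [mul_assoc]
            exact ((T.op τ).le_opNorm z).trans (by gcongr)
          · rw [mul_assoc]
            refine hwn.trans ((mul_le_mul_of_nonneg_right (le_abs_self L) (norm_nonneg _)).trans ?_)
            gcongr
            exact (S.op s).le_opNorm _
  have hlin : ∀ t : ℝ≥0, ∃ W : Y →L[𝕜] X, ∀ g : S.generator.domain,
      T.incl lam hlam (W g) = T.controlInt lam hlam B t (S.output C g) := by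
    intro t
    obtain ⟨M, hM⟩ := hbd t
    -- The chosen values depend linearly on `g` because `incl` is injective and the control integral
    -- is linear in the input.
    choose z hz hzn using hM
    let f : S.generator.domain →ₗ[𝕜] X :=
      { toFun := z
        map_add' := fun g h => T.incl_injective lam hlam (by
          rw [map_add, hz, hz, hz, ← controlInt_add_fun _ (continuous_output hCb g)
            (continuous_output hCb h)]
          congr 1
          ext s
          exact output_add g h s)
        map_smul' := fun c g => T.incl_injective lam hlam (by
          rw [RingHom.id_apply, map_smul, hz, hz, ← controlInt_smul_fun]
          congr 1
          ext s
          exact output_smul c g s) }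
    have hd : DenseRange S.generator.domain.subtype := by
      simpa [DenseRange] using S.dense_domain
    refine ⟨f.extendOfNorm S.generator.domain.subtype, fun g => ?_⟩
    rw [← hz g]
    congr 1
    exact LinearMap.extendOfNorm_eq hd ⟨M, hzn⟩ g
  choose W hW using hlin
  exact ⟨W, hW⟩

variable {W : ℝ≥0 → Y →L[𝕜] X}

/-- The composition rule for control integrals gives this on `D(𝐀)`, after cancelling the embedding
into `X_{-1}`; density does the rest. -/
theorem coupling_add [CompleteSpace X] [CompleteSpace Y] (hCb : S.generator.GraphBounded C)
    (hW : ∀ t (g : S.generator.domain),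
      T.incl lam hlam (W t g) = T.controlInt lam hlam B t (S.output C g)) (s t : ℝ≥0) (y : Y) :
    W (s + t) y = T.op s (W t y) + W s (S.op t y) := by
  have hd : DenseRange ((↑) : S.generator.domain → Y) := by
    simpa [DenseRange] using S.dense_domain
  refine hd.induction_on (p := fun y => W (s + t) y = T.op s (W t y) + W s (S.op t y)) y
    (isClosed_eq (by fun_prop) (by fun_prop)) fun g => ?_
  apply T.incl_injective lam hlam
  rw [map_add, hW, controlInt_output_add hCb, ← extrapOp_incl, hW,
    ← hW s ⟨S.op t g, S.op_mem_domain t g⟩]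

theorem exists_norm_coupling_le [CompleteSpace X] [CompleteSpace Y]
    (hB : T.AdmissibleControl lam hlam B)
    (hCb : S.generator.GraphBounded C) (hC : S.AdmissibleObservation C)
    (hW : ∀ t (g : S.generator.domain),
      T.incl lam hlam (W t g) = T.controlInt lam hlam B t (S.output C g)) :
    ∃ τ : ℝ≥0, 0 < τ ∧ ∃ M : ℝ, ∀ t ≤ τ, ‖W t‖ ≤ M := by
  obtain ⟨τ, hτ, K, L, h⟩ := exists_short_coupling hB hCb hC
  refine ⟨τ, hτ, |L|, fun t ht => ContinuousLinearMap.opNorm_le_bound _ (abs_nonneg L) fun y => ?_⟩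
  have hd : DenseRange ((↑) : S.generator.domain → Y) := by
    simpa [DenseRange] using S.dense_domain
  refine hd.induction_on (p := fun y => ‖W t y‖ ≤ |L| * ‖y‖) y
    (isClosed_le (by fun_prop) (by fun_prop)) fun g => ?_
  obtain ⟨z, hz, -, hzn⟩ := h t ht g
  rw [← hW] at hz
  rw [← T.incl_injective lam hlam hz]
  exact hzn.trans (mul_le_mul_of_nonneg_right (le_abs_self L) (norm_nonneg _))

/-- The `L²` norm over `[0, t]` of a fixed continuous output vanishes as `t → 0`. -/
theorem tendsto_coupling_zero [CompleteSpace X]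
    (hB : T.AdmissibleControl lam hlam B)
    (hCb : S.generator.GraphBounded C) (hC : S.AdmissibleObservation C)
    (hW : ∀ t (g : S.generator.domain),
      T.incl lam hlam (W t g) = T.controlInt lam hlam B t (S.output C g))
    (g : S.generator.domain) : Tendsto (fun t => W t g) (𝓝 0) (𝓝 0) := by
  obtain ⟨τ, hτ, K, L, h⟩ := exists_short_coupling hB hCb hC
  have h1 : Continuous fun t : ℝ≥0 => K * √(∫ s in (0 : ℝ)..t, ‖S.output C g s‖ ^ 2) := by
    have h2 : Continuous fun t : ℝ => ∫ s in (0 : ℝ)..t, ‖S.output C g s‖ ^ 2 :=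
      intervalIntegral.continuous_primitive
        (fun a b => ((continuous_output hCb g).norm.pow 2).intervalIntegrable a b) 0
    exact continuous_const.mul ((h2.comp NNReal.continuous_coe).sqrt)
  have h3 := h1.tendsto 0
  simp only [NNReal.coe_zero, intervalIntegral.integral_same, Real.sqrt_zero, mul_zero] at h3
  rw [tendsto_zero_iff_norm_tendsto_zero]
  refine squeeze_zero' (Eventually.of_forall fun t => norm_nonneg _) ?_ h3
  filter_upwards [Iic_mem_nhds hτ] with t ht
  obtain ⟨z, hz, hzn, -⟩ := h t ht g
  rw [← hW] at hz
  rwa [← T.incl_injective lam hlam hz]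

end Coupling

/-! ### Block triangular semigroups -/

section Triangular

/-- The block operator `(f, g) ↦ (P f + Q g, R g)`. -/
def blockOp (P : X →L[𝕜] X) (Q : Y →L[𝕜] X) (R : Y →L[𝕜] Y) : X × Y →L[𝕜] X × Y :=
  (P.comp (ContinuousLinearMap.fst 𝕜 X Y) + Q.comp (ContinuousLinearMap.snd 𝕜 X Y)).prod
    (R.comp (ContinuousLinearMap.snd 𝕜 X Y))

theorem blockOp_apply (P : X →L[𝕜] X) (Q : Y →L[𝕜] X) (R : Y →L[𝕜] Y) (p : X × Y) :
    blockOp P Q R p = (P p.1 + Q p.2, R p.2) := rfl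

theorem norm_blockOp_le (P : X →L[𝕜] X) (Q : Y →L[𝕜] X) (R : Y →L[𝕜] Y) :
    ‖blockOp P Q R‖ ≤ ‖P‖ + ‖Q‖ + ‖R‖ := by
  refine ContinuousLinearMap.opNorm_le_bound _ (by positivity) fun p => ?_
  have h1 : ‖P p.1‖ ≤ ‖P‖ * ‖p‖ :=
    (P.le_opNorm _).trans (mul_le_mul_of_nonneg_left (norm_fst_le p) (norm_nonneg _))
  have h2 : ‖Q p.2‖ ≤ ‖Q‖ * ‖p‖ :=
    (Q.le_opNorm _).trans (mul_le_mul_of_nonneg_left (norm_snd_le p) (norm_nonneg _))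
  have h3 : ‖R p.2‖ ≤ ‖R‖ * ‖p‖ :=
    (R.le_opNorm _).trans (mul_le_mul_of_nonneg_left (norm_snd_le p) (norm_nonneg _))
  have h4 := norm_add_le (P p.1) (Q p.2)
  have h5 := norm_nonneg (R p.2)
  have h6 : 0 ≤ ‖P‖ * ‖p‖ := by positivity
  have h7 : 0 ≤ ‖Q‖ * ‖p‖ := by positivity
  have h8 : 0 ≤ ‖R‖ * ‖p‖ := by positivity
  rw [blockOp_apply, Prod.norm_def, add_mul, add_mul]
  exact max_le (by linarith) (by linarith)

variable (T : C0Semigroup 𝕜 X) (S : C0Semigroup 𝕜 Y) (W : ℝ≥0 → Y →L[𝕜] X)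

/-- The block triangular semigroup with diagonal `T`, `S` and off-diagonal entry `W`. -/
def triangular [CompleteSpace X] [CompleteSpace Y]
    (hadd : ∀ s t y, W (s + t) y = T.op s (W t y) + W s (S.op t y))
    (hbd : ∃ τ : ℝ≥0, 0 < τ ∧ ∃ M : ℝ, ∀ t ≤ τ, ‖W t‖ ≤ M)
    (hlim : ∀ g : S.generator.domain, Tendsto (fun t => W t g) (𝓝 0) (𝓝 0)) :
    C0Semigroup 𝕜 (X × Y) :=
  ofDense (fun t => blockOp (T.op t) (W t) (S.op t))
    (by
      refine ContinuousLinearMap.ext fun p => ?_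
      -- At `s = t = 0` the rule reads `W(0) y = W(0) y + W(0) y`, so `W(0) = 0`.
      have h := hadd 0 0 p.2
      rw [op_zero_apply, op_zero_apply, add_zero, left_eq_add] at h
      rw [blockOp_apply, op_zero_apply, op_zero_apply, h, add_zero]
      rfl)
    (by
      intro s t
      refine ContinuousLinearMap.ext fun p => ?_
      simp only [ContinuousLinearMap.comp_apply, blockOp_apply, op_add_apply, hadd, map_add,
        add_assoc])
    hbd.choose hbd.choose_spec.1
    ((T.exists_norm_op_le hbd.choose).choose + hbd.choose_spec.2.choose +
      (S.exists_norm_op_le hbd.choose).choose)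
    (fun t ht => (norm_blockOp_le _ _ _).trans (add_le_add (add_le_add
      ((T.exists_norm_op_le _).choose_spec.2 t ht) (hbd.choose_spec.2.choose_spec t ht))
      ((S.exists_norm_op_le _).choose_spec.2 t ht)))
    (univ ×ˢ (S.generator.domain : Set Y)) (dense_univ.prod S.dense_domain)
    (by
      rintro ⟨x, y⟩ ⟨-, hy⟩
      have h1 := (T.continuous_op x).tendsto 0
      have h2 := (S.continuous_op y).tendsto 0
      rw [op_zero_apply] at h1 h2
      have h3 := h1.add (hlim ⟨y, hy⟩)
      rw [add_zero] at h3
      exact h3.prodMk_nhds h2)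

/-- If the second component of a semigroup on a product evolves by `S`, then every element of the
domain of the generator of `S` is the second component of an element of the domain of the generator
of the product semigroup. -/
theorem exists_hasGen_of_snd [CompleteSpace X] [CompleteSpace Y] (V : C0Semigroup 𝕜 (X × Y))
    (hV : ∀ t p, (V.op t p).2 = S.op t p.2) (g : S.generator.domain) :
    ∃ f q, V.HasGen (f, (g : Y)) q := by
  obtain ⟨c, hc⟩ : ∃ c : ℝ, ‖(S.rescale c).op 1‖ < 1 := by
    -- The rescaled norm is `‖S(1)‖ / (‖S(1)‖ + 1)`.
    refine ⟨Real.log (‖S.op 1‖ + 1), ?_⟩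
    rw [norm_rescale_op, NNReal.coe_one, mul_one, Real.exp_neg, Real.exp_log (by positivity),
      inv_mul_lt_one₀ (by positivity)]
    linarith
  set V' := V.rescale c with hV'
  set S' := S.rescale c with hS'
  have hVS : ∀ t p, (V'.op t p).2 = S'.op t p.2 := by
    intro t p
    rw [hV', hS', rescale_op_apply, rescale_op_apply, Prod.smul_snd, hV]
  have hsnd : ∀ {p q}, V'.HasGen p q → S'.HasGen p.2 q.2 := by
    intro p q h
    refine (h.snd_nhds).congr fun t => ?_
    rw [Prod.smul_snd, Prod.snd_sub, hVS]
  have hg := (S.hasGen_generator g).rescale c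
  rw [← hS'] at hg
  set w := S.generator g - (c : 𝕜) • (g : Y)
  -- `1 - S'(1)` is invertible by the Neumann series. With this `y`, the orbit integral of `(0, y)`
  -- over `[0, 1]` is an element `m` of the domain, and the generator of `V'` sends it to a vector
  -- with second component `S'(1) y - y = -w`.
  obtain ⟨y, hy⟩ : ∃ y, y - S'.op 1 y = w := by
    let u := Units.oneSub (S'.op 1) hc
    refine ⟨(↑u⁻¹ : Y →L[𝕜] Y) w, ?_⟩
    have := DFunLike.congr_fun u.mul_inv w
    exact this
  obtain ⟨m, hm⟩ := V'.exists_hasGen_op_sub 1 (0, y)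
  have h1 := hsnd hm
  rw [Prod.snd_sub, hVS] at h1
  have h2 : S'.HasGen (m.2 + g) 0 := by
    have e : S'.op 1 y - y + w = 0 := by rw [← hy]; abel
    have := h1.add hg
    rwa [e] at this
  -- A kernel element of the generator is fixed by `S'(1)`, whose norm is less than one.
  have h3 : m.2 + g = 0 := by
    by_contra hne
    have h4 := (S'.op 1).le_opNorm (m.2 + g)
    rw [h2.op_eq_of_zero] at h4
    have h5 : 0 < ‖m.2 + (g : Y)‖ := norm_pos_iff.2 hne
    nlinarith
  have h6 := hasGen_of_rescale (hm.smul (-1))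
  have e : (-1 : 𝕜) • m = (-m.1, (g : Y)) := by
    rw [neg_one_smul]
    exact Prod.ext rfl (neg_eq_of_add_eq_zero_right h3)
  rw [e] at h6
  exact ⟨_, _, h6⟩

end Triangular

/-! ### Identification of the generator, and stability -/

section Main

variable {T : C0Semigroup 𝕜 X} {lam : 𝕜} {hlam : lam ∈ T.generator.resolventSet}
variable {B : U →L[𝕜] T.Extrap lam hlam}
variable {S : C0Semigroup 𝕜 Y} {C : S.generator.domain →ₗ[𝕜] U}
variable {W : ℝ≥0 → Y →L[𝕜] X} {V : C0Semigroup 𝕜 (X × Y)}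

/-- The generator of the block triangular semigroup is contained in the coupled operator. -/
theorem isCoupled_of_hasGen [CompleteSpace X] (hCb : S.generator.GraphBounded C)
    (hW : ∀ t (g : S.generator.domain),
      T.incl lam hlam (W t g) = T.controlInt lam hlam B t (S.output C g))
    (hV : ∀ t p, V.op t p = (T.op t p.1 + W t p.2, S.op t p.2)) {p q : X × Y}
    (h : V.HasGen p q) : T.IsCoupled lam hlam S B C p q.1 ∧ S.HasGen p.2 q.2 := by
  have h2 : S.HasGen p.2 q.2 := by
    refine (h.snd_nhds).congr fun t => ?_
    rw [Prod.smul_snd, Prod.snd_sub, hV]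
  have hg : p.2 ∈ S.generator.domain := ⟨_, h2⟩
  refine ⟨⟨hg, ?_⟩, h2⟩
  have h3 := ((T.incl lam hlam).continuous.tendsto q.1).comp (h.fst_nhds)
  have h4 : Tendsto (fun h : ℝ≥0 => ((h : ℝ) : 𝕜)⁻¹ •
      (T.incl lam hlam (T.op h p.1) - T.incl lam hlam p.1)) (𝓝[>] 0)
      (𝓝 (T.extrapGen lam hlam p.1)) := by
    simpa only [HasGen, extrapSemigroup_op, extrapOp_incl] using
      T.hasGen_extrapSemigroup lam hlam p.1
  have h5 := tendsto_average_controlInt (T := T) (B := B) (continuous_output hCb ⟨p.2, hg⟩)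
  rw [output_zero] at h5
  -- The same difference quotient is read in `X_{-1}` in two ways: through the limit in `X`, and as
  -- a sum of the quotients of `T` and `W`.
  refine tendsto_nhds_unique (h4.add h5) (h3.congr fun t => ?_)
  have e := hW t ⟨p.2, hg⟩
  rw [Function.comp_apply, Prod.smul_fst, Prod.fst_sub, hV, ← e, map_smul, map_sub, map_add,
    ← smul_add]
  congr 1
  abel

/-- Subtracting an element of the generator's domain with the same second component leaves `(x, 0)`
with `A x ∈ X`, that is, `x ∈ D(A)`; on such vectors `V` acts as `T`. -/
theorem hasGen_of_isCoupled [CompleteSpace X] [CompleteSpace Y]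
    (hCb : S.generator.GraphBounded C)
    (hW : ∀ t (g : S.generator.domain),
      T.incl lam hlam (W t g) = T.controlInt lam hlam B t (S.output C g))
    (hV : ∀ t p, V.op t p = (T.op t p.1 + W t p.2, S.op t p.2)) {p : X × Y} {z : X}
    (h : T.IsCoupled lam hlam S B C p z) : ∃ q, V.HasGen p q := by
  obtain ⟨hg, hz⟩ := h
  obtain ⟨f, q, hq⟩ := exists_hasGen_of_snd S V (fun t p => by rw [hV]) ⟨p.2, hg⟩
  obtain ⟨⟨_, hf⟩, -⟩ := isCoupled_of_hasGen hCb hW hV hq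
  have h1 : T.HasGen (p.1 - f) (z - q.1) := by
    refine T.hasGen_of_extrapGen_eq lam hlam ?_
    rw [map_sub, map_sub, ← hz, ← hf]
    simp only
    abel
  have h2 : V.HasGen (p.1 - f, 0) (z - q.1, 0) := by
    refine (h1.prodMk_nhds (tendsto_const_nhds (x := (0 : Y)))).congr fun t => ?_
    rw [hV]
    simp
  have h3 := hq.add h2
  have e : (f, p.2) + (p.1 - f, 0) = p := Prod.ext (add_sub_cancel f p.1) (add_zero p.2)
  rw [e] at h3
  exact ⟨_, h3⟩

theorem generator_eq_coupledOp [CompleteSpace X] [CompleteSpace Y]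
    (hCb : S.generator.GraphBounded C)
    (hW : ∀ t (g : S.generator.domain),
      T.incl lam hlam (W t g) = T.controlInt lam hlam B t (S.output C g))
    (hV : ∀ t p, V.op t p = (T.op t p.1 + W t p.2, S.op t p.2)) :
    V.generator = T.coupledOp lam hlam S B C := by
  refine LinearPMap.ext ?_ ?_
  · ext p
    constructor
    · rintro ⟨q, hq⟩
      exact ⟨q.1, (isCoupled_of_hasGen hCb hW hV hq).1⟩
    · rintro ⟨z, hz⟩
      exact hasGen_of_isCoupled hCb hW hV hz
  · intro p hp hp'
    obtain ⟨⟨hg, h1⟩, h2⟩ := isCoupled_of_hasGen hCb hW hV (V.hasGen_generator ⟨p, hp⟩)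
    obtain ⟨e1, e2⟩ := T.coupledOp_apply lam hlam S B C ⟨p, hp'⟩ hg
    refine Prod.ext (T.incl_injective lam hlam (h1.symm.trans e1.symm)) ?_
    rw [e2]
    exact h2.unique (S.hasGen_generator ⟨_, hg⟩)

theorem ExpStable.tendsto_norm {R : C0Semigroup 𝕜 X} (hR : R.ExpStable) :
    Tendsto (fun t => ‖R.op t‖) atTop (𝓝 0) := by
  obtain ⟨M, ω, -, hω, h⟩ := hR
  refine squeeze_zero (fun t => norm_nonneg _) h ?_
  have h1 : Tendsto (fun t : ℝ≥0 => -ω * (t : ℝ)) atTop atBot :=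
    (NNReal.tendsto_coe_atTop.2 tendsto_id).const_mul_atTop_of_neg (neg_lt_zero.2 hω)
  simpa using (Real.tendsto_exp_atBot.comp h1).const_mul M

/-- Exponential stability of the diagonal entries is inherited by the triangular semigroup. -/
theorem expStable_of_triangular [CompleteSpace X] [CompleteSpace Y]
    (hadd : ∀ s t y, W (s + t) y = T.op s (W t y) + W s (S.op t y))
    (hV : ∀ t, V.op t = blockOp (T.op t) (W t) (S.op t))
    (hT : T.ExpStable) (hS : S.ExpStable) : V.ExpStable := by
  have hT0 := hT.tendsto_norm
  have hS0 := hS.tendsto_norm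
  have hTS := hT0.add hS0
  rw [add_zero] at hTS
  have hW2 : ∀ s, ‖W (s + s)‖ ≤ (‖T.op s‖ + ‖S.op s‖) * ‖W s‖ := by
    intro s
    have e : W (s + s) = (T.op s).comp (W s) + (W s).comp (S.op s) :=
      ContinuousLinearMap.ext fun y => hadd s s y
    rw [e, add_mul, mul_comm ‖S.op s‖]
    exact (norm_add_le _ _).trans (add_le_add (ContinuousLinearMap.opNorm_comp_le _ _)
      (ContinuousLinearMap.opNorm_comp_le _ _))
  -- The bound `1/2` is needed at every time from `a` on, because the doubling estimate is applied
  -- at each `2ⁿ a`.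
  obtain ⟨a, ha⟩ := eventually_atTop.1
    ((hTS.eventually_lt_const (show (0 : ℝ) < 1 / 2 by norm_num)).and (eventually_gt_atTop 0))
  have ha0 : 0 < a := (ha a le_rfl).2
  have hge : ∀ n : ℕ, a ≤ 2 ^ n * a := fun n =>
    le_mul_of_one_le_left zero_le (one_le_pow₀ one_le_two)
  have hWn : ∀ n : ℕ, ‖W (2 ^ n * a)‖ ≤ (1 / 2) ^ n * ‖W a‖ := by
    intro n
    induction n with
    | zero => simp
    | succ n ih =>
      have e : (2 : ℝ≥0) ^ (n + 1) * a = 2 ^ n * a + 2 ^ n * a := by ring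
      rw [e, pow_succ' (1 / 2 : ℝ), mul_assoc]
      exact (hW2 _).trans (mul_le_mul (ha _ (hge n)).1.le ih (norm_nonneg _) (by norm_num))
  have hW0 : Tendsto (fun n : ℕ => ‖W (2 ^ n * a)‖) atTop (𝓝 0) := by
    refine squeeze_zero (fun n => norm_nonneg _) hWn ?_
    simpa using (tendsto_pow_atTop_nhds_zero_of_lt_one (r := (1 / 2 : ℝ)) (by norm_num)
      (by norm_num)).mul_const ‖W a‖
  have hat : Tendsto (fun n : ℕ => (2 : ℝ≥0) ^ n * a) atTop atTop :=
    (tendsto_pow_atTop_atTop_of_one_lt one_lt_two).atTop_mul_const ha0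
  have hsum := ((hT0.comp hat).add hW0).add (hS0.comp hat)
  rw [add_zero, add_zero] at hsum
  obtain ⟨n, hn⟩ := (hsum.eventually_lt_const one_pos).exists
  refine V.expStable_of_norm_lt_one (a := 2 ^ n * a) (by positivity) ?_
  rw [hV]
  exact (norm_blockOp_le _ _ _).trans_lt hn

end Main

end C0Semigroup

end

theorem theorem1 {𝕜 : Type*} [RCLike 𝕜]
    {X : Type*} [NormedAddCommGroup X] [NormedSpace 𝕜 X] [CompleteSpace X]
    {Y : Type*} [NormedAddCommGroup Y] [NormedSpace 𝕜 Y] [CompleteSpace Y]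
    {U : Type*} [NormedAddCommGroup U] [NormedSpace 𝕜 U] [CompleteSpace U]
    (T : C0Semigroup 𝕜 X) (S : C0Semigroup 𝕜 Y)
    (lam : 𝕜) (hlam : lam ∈ T.generator.resolventSet)
    (B : U →L[𝕜] T.Extrap lam hlam) (hB : T.AdmissibleControl lam hlam B)
    (C : S.generator.domain →ₗ[𝕜] U) (hCbdd : S.generator.GraphBounded C)
    (hC : S.AdmissibleObservation C) :
    ∃ V : C0Semigroup 𝕜 (X × Y), V.generator = T.coupledOp lam hlam S B C ∧
      (T.ExpStable → S.ExpStable → V.ExpStable) := by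
  obtain ⟨W, hW⟩ := C0Semigroup.exists_coupling hB hCbdd hC
  have hadd := C0Semigroup.coupling_add hCbdd hW
  refine ⟨C0Semigroup.triangular T S W hadd (C0Semigroup.exists_norm_coupling_le hB hCbdd hC hW)
    (C0Semigroup.tendsto_coupling_zero hB hCbdd hC hW),
    C0Semigroup.generator_eq_coupledOp hCbdd hW fun t p => rfl,
    C0Semigroup.expStable_of_triangular hadd fun t => rfl⟩
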